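/- Let $V$ be a finite dimensional complex vector space with a symplectic form $\omega$ (a nondegenerate alternating bilinear form), and let $G$ be a finite group acting faithfully and linearly on $V$ and preserving $\omega$. Assume that $(\wedge^2V)^G=\mathbb{C}\omega$, i.e. (identifying $V$ with $V^*$ by $\omega$) every $G$-invariant alternating bilinear form on $V$ is a scalar multiple of $\omega$. Let $S\subset G$ be the set of symplectic reflections, i.e. of those $s\in G$ for which $1-s$ has rank $2$ on $V$. For $s\in S$ let $\omega_s(x,y)$ be $\omega$ applied to the projections of $x,y$ to the image of $1-s$ along the kernel of $1-s$. Let $\kappa:\wedge^2V\to\mathbb{C}[G]$ be a $G$-equivariant linear map, where $G$ acts on $\mathbb{C}[G]$ by conjugation. Let $G\ltimes T(V)$ and $G\ltimes SV$ be the semidirect products of $G$ with the tensor algebra and the symmetric algebra of $V$ (so that $gxg^{-1}=g(x)$ for $g\in G$, $x\in V$), and let $H_\kappa$ be the quotient of $G\ltimes T(V)$ by the two-sided ideal generated by the relations $[x,y]=\kappa(x,y)$, $x,y\in V$. Put on $H_\kappa$ the increasing filtration with $\deg V=1$, $\deg G=0$, whose $n$-th step is spanned by the images of $x_1\cdots x_k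 g$ with $k\le n$, $x_i\in V$, $g\in G$. Let $\xi: G\ltimes SV\to \mathrm{gr}\,H_\kappa$ be the natural surjective algebra homomorphism, sending $x\in V$ to its class in degree $1$ and $g\in G$ to its class in degree $0$. Then $\xi$ is an isomorphism if and only if there are $t\in\mathbb{C}$ and a function $c:S\to\mathbb{C}$, invariant under conjugation by $G$, such that $$\kappa(x,y)=t\,\omega(x,y)-2\sum_{s\in S}c_s\,\omega_s(x,y)\,s\qquad\text{for all }x,y\in V.$$ -/

import Mathlib

open scoped DirectSum

noncomputable section

namespace SymplecticReflection

/-! ### The associated graded algebra of a filtered algebra -/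

section AssociatedGraded

variable {R A : Type*} [CommRing R] [Ring A] [Algebra R A] (F : ℕ → Submodule R A)

/-- The previous step `F (n - 1)` of the filtration, with the convention `F (-1) = 0`. -/
def prevStep : ℕ → Submodule R A
  | 0 => ⊥
  | n + 1 => F n

/-- The `n`-th graded piece `F n / F (n - 1)`. -/
def GrPiece (n : ℕ) : Type _ := F n ⧸ (prevStep F n).submoduleOf (F n)

instance (n : ℕ) : AddCommGroup (GrPiece F n) :=
  inferInstanceAs (AddCommGroup (F n ⧸ (prevStep F n).submoduleOf (F n)))

instance (n : ℕ) : Module R (GrPiece F n) :=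
  inferInstanceAs (Module R (F n ⧸ (prevStep F n).submoduleOf (F n)))

/-- The class in `F n / F (n - 1)` of an element of `F n`. -/
def grMk (n : ℕ) : F n →ₗ[R] GrPiece F n := ((prevStep F n).submoduleOf (F n)).mkQ

theorem grMk_surjective (n : ℕ) : Function.Surjective (grMk F n) :=
  Submodule.mkQ_surjective _

theorem grMk_eq_zero {n : ℕ} {a : F n} (h : (a : A) ∈ prevStep F n) : grMk F n a = 0 :=
  (Submodule.Quotient.mk_eq_zero _).2 h

theorem grMk_sigma_eq {m n : ℕ} (h : m = n) {a : F m} {b : F n} (hab : (a : A) = b) :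
    GradedMonoid.mk (A := GrPiece F) m (grMk F m a) = GradedMonoid.mk n (grMk F n b) := by
  subst h
  rw [Subtype.ext hab]

/-- The associated graded algebra `gr A = ⨁ n, F n / F (n - 1)`. -/
abbrev Gr : Type _ := ⨁ n, GrPiece F n

/-- The class in degree `n` of `gr A` of an element of `F n`. -/
def symbol (n : ℕ) : F n →ₗ[R] Gr F := DirectSum.lof R ℕ (GrPiece F) n ∘ₗ grMk F n

theorem symbol_congr {m n : ℕ} (h : m = n) {a : F m} {b : F n} (hab : (a : A) = b) :
    symbol F m a = symbol F n b := by
  subst h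
  rw [Subtype.ext hab]

theorem symbol_eq_zero {n : ℕ} {a : F n} (h : (a : A) ∈ prevStep F n) : symbol F n a = 0 := by
  simp [symbol, grMk_eq_zero F h]

variable [SetLike.GradedMonoid F]

theorem mul_mem_prevStep_left {i j : ℕ} {a b : A} (ha : a ∈ prevStep F i) (hb : b ∈ F j) :
    a * b ∈ prevStep F (i + j) := by
  cases i with
  | zero =>
    have : a = 0 := ha
    simp [this]
  | succ i =>
    rw [Nat.succ_add]
    exact SetLike.mul_mem_graded (A := F) ha hb

theorem mul_mem_prevStep_right {i j : ℕ} {a b : A} (ha : a ∈ F i) (hb : b ∈ prevStep F j) :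
    a * b ∈ prevStep F (i + j) := by
  cases j with
  | zero =>
    have : b = 0 := hb
    simp [this]
  | succ j => exact SetLike.mul_mem_graded (A := F) ha hb

/-- Multiplication `F i × F j → F (i + j)`. -/
def filtMul (i j : ℕ) : F i →ₗ[R] F j →ₗ[R] F (i + j) :=
  LinearMap.mk₂ R (fun a b => ⟨(a : A) * b, SetLike.mul_mem_graded a.2 b.2⟩)
    (fun _ _ _ => Subtype.ext (by simp [add_mul]))
    (fun _ _ _ => Subtype.ext (by simp))
    (fun _ _ _ => Subtype.ext (by simp [mul_add]))
    (fun _ _ _ => Subtype.ext (by simp))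

/-- The product `gr_i × gr_j → gr_{i+j}` induced by the multiplication of `A`. -/
def grMul (i j : ℕ) : GrPiece F i →ₗ[R] GrPiece F j →ₗ[R] GrPiece F (i + j) :=
  Submodule.liftQ ((prevStep F i).submoduleOf (F i))
    (LinearMap.flip (Submodule.liftQ ((prevStep F j).submoduleOf (F j))
      (LinearMap.flip ((filtMul F i j).compr₂ (grMk F (i + j))))
      (fun b hb => by
        refine LinearMap.mem_ker.2 (LinearMap.ext fun a => ?_)
        exact grMk_eq_zero F (mul_mem_prevStep_right F a.2 hb))))
    (fun a ha => by
      refine LinearMap.mem_ker.2 (LinearMap.ext fun b => ?_)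
      obtain ⟨b, rfl⟩ := grMk_surjective F j b
      exact grMk_eq_zero F (mul_mem_prevStep_left F ha b.2))

theorem grMul_mk {i j : ℕ} (a : F i) (b : F j) :
    grMul F i j (grMk F i a) (grMk F j b) =
      grMk F (i + j) ⟨(a : A) * b, SetLike.mul_mem_graded a.2 b.2⟩ := rfl

instance grGMul : GradedMonoid.GMul (GrPiece F) where
  mul a b := grMul F _ _ a b

instance grGOne : GradedMonoid.GOne (GrPiece F) where
  one := grMk F 0 ⟨1, SetLike.one_mem_graded F⟩

instance grGRing : DirectSum.GRing (GrPiece F) where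
  mul_zero a := map_zero (grMul F _ _ a)
  zero_mul b := by
    change grMul F _ _ 0 b = 0
    simp
  mul_add a b c := map_add (grMul F _ _ a) b c
  add_mul a b c := by
    change grMul F _ _ (a + b) c = grMul F _ _ a c + grMul F _ _ b c
    simp
  one_mul := by
    rintro ⟨i, a⟩
    obtain ⟨a, rfl⟩ := grMk_surjective F i a
    exact grMk_sigma_eq F (zero_add i) (one_mul _)
  mul_one := by
    rintro ⟨i, a⟩
    obtain ⟨a, rfl⟩ := grMk_surjective F i a
    exact grMk_sigma_eq F (add_zero i) (mul_one _)
  mul_assoc := by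
    rintro ⟨i, a⟩ ⟨j, b⟩ ⟨k, c⟩
    obtain ⟨a, rfl⟩ := grMk_surjective F i a
    obtain ⟨b, rfl⟩ := grMk_surjective F j b
    obtain ⟨c, rfl⟩ := grMk_surjective F k c
    exact grMk_sigma_eq F (add_assoc i j k) (mul_assoc _ _ _)
  natCast n := n • grMk F 0 ⟨1, SetLike.one_mem_graded F⟩
  natCast_zero := zero_nsmul _
  natCast_succ n := succ_nsmul _ n
  intCast n := n • grMk F 0 ⟨1, SetLike.one_mem_graded F⟩
  intCast_ofNat n := natCast_zsmul _ n
  intCast_negSucc_ofNat n := negSucc_zsmul _ n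

instance grGAlgebra : DirectSum.GAlgebra R (GrPiece F) where
  toFun := (grMk F 0 ∘ₗ
    LinearMap.toSpanSingleton R (F 0) ⟨1, SetLike.one_mem_graded F⟩).toAddMonoidHom
  map_one := congrArg (grMk F 0) (one_smul R _)
  map_mul r s := by
    exact grMk_sigma_eq F (a := (r * s) • ⟨1, SetLike.one_mem_graded F⟩)
      (b := filtMul F 0 0 (r • ⟨1, SetLike.one_mem_graded F⟩) (s • ⟨1, SetLike.one_mem_graded F⟩))
      (add_zero 0).symm (by simp [filtMul, mul_smul, smul_comm r s])
  commutes := by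
    rintro r ⟨i, a⟩
    obtain ⟨a, rfl⟩ := grMk_surjective F i a
    exact grMk_sigma_eq F (a := filtMul F 0 i (r • ⟨1, SetLike.one_mem_graded F⟩) a)
      (b := filtMul F i 0 a (r • ⟨1, SetLike.one_mem_graded F⟩))
      (add_comm 0 i) (by simp [filtMul])
  smul_def := by
    rintro r ⟨i, a⟩
    obtain ⟨a, rfl⟩ := grMk_surjective F i a
    exact grMk_sigma_eq F (a := r • a)
      (b := filtMul F 0 i (r • ⟨1, SetLike.one_mem_graded F⟩) a)
      (zero_add i).symm (by simp [filtMul])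

theorem symbol_mul {i j : ℕ} (a : F i) (b : F j) :
    symbol F i a * symbol F j b =
      symbol F (i + j) ⟨(a : A) * b, SetLike.mul_mem_graded a.2 b.2⟩ :=
  DirectSum.of_mul_of (A := GrPiece F) _ _

theorem symbol_one : symbol F 0 ⟨1, SetLike.one_mem_graded F⟩ = 1 := rfl

end AssociatedGraded

/-! ### The semidirect products `G ⋉ T(V)` and `G ⋉ S(V)` -/

section Smash

variable (V G : Type*) [AddCommGroup V] [Module ℂ V] [Group G] [DistribMulAction G V]
  [SMulCommClass G ℂ V]

variable {G} in
/-- The linear operator on `V` given by a group element. -/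
abbrev act (g : G) : V →ₗ[ℂ] V := DistribSMul.toLinearMap ℂ V g

/-- The action of `G` on the tensor algebra by algebra automorphisms extending that on `V`. -/
instance tensorAction : MulSemiringAction G (TensorAlgebra ℂ V) where
  smul g := TensorAlgebra.lift ℂ (TensorAlgebra.ι ℂ ∘ₗ act V g)
  one_smul a := by
    change TensorAlgebra.lift ℂ (TensorAlgebra.ι ℂ ∘ₗ act V (1 : G)) a = AlgHom.id ℂ _ a
    congr 1
    ext x
    simp
  mul_smul g h a := by
    change TensorAlgebra.lift ℂ (TensorAlgebra.ι ℂ ∘ₗ act V (g * h)) a =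
      ((TensorAlgebra.lift ℂ (TensorAlgebra.ι ℂ ∘ₗ act V g)).comp
        (TensorAlgebra.lift ℂ (TensorAlgebra.ι ℂ ∘ₗ act V h))) a
    congr 1
    ext x
    simp [mul_smul]
  smul_zero g := map_zero (TensorAlgebra.lift ℂ (TensorAlgebra.ι ℂ ∘ₗ act V g))
  smul_add g := map_add (TensorAlgebra.lift ℂ (TensorAlgebra.ι ℂ ∘ₗ act V g))
  smul_one g := map_one (TensorAlgebra.lift ℂ (TensorAlgebra.ι ℂ ∘ₗ act V g))
  smul_mul g := map_mul (TensorAlgebra.lift ℂ (TensorAlgebra.ι ℂ ∘ₗ act V g))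

instance tensorAction_comm : SMulCommClass G ℂ (TensorAlgebra ℂ V) where
  smul_comm g r := map_smul (TensorAlgebra.lift ℂ (TensorAlgebra.ι ℂ ∘ₗ act V g)) r

/-- The action of `G` on the symmetric algebra by algebra automorphisms extending that on `V`. -/
instance symAction : MulSemiringAction G (SymmetricAlgebra ℂ V) where
  smul g := SymmetricAlgebra.lift (SymmetricAlgebra.ι ℂ V ∘ₗ act V g)
  one_smul a := by
    change SymmetricAlgebra.lift (SymmetricAlgebra.ι ℂ V ∘ₗ act V (1 : G)) a = AlgHom.id ℂ _ a
    congr 1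
    apply SymmetricAlgebra.algHom_ext
    ext x
    simp
  mul_smul g h a := by
    change SymmetricAlgebra.lift (SymmetricAlgebra.ι ℂ V ∘ₗ act V (g * h)) a =
      ((SymmetricAlgebra.lift (SymmetricAlgebra.ι ℂ V ∘ₗ act V g)).comp
        (SymmetricAlgebra.lift (SymmetricAlgebra.ι ℂ V ∘ₗ act V h))) a
    congr 1
    apply SymmetricAlgebra.algHom_ext
    ext x
    simp [mul_smul]
  smul_zero g := map_zero (SymmetricAlgebra.lift (SymmetricAlgebra.ι ℂ V ∘ₗ act V g))
  smul_add g := map_add (SymmetricAlgebra.lift (SymmetricAlgebra.ι ℂ V ∘ₗ act V g))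
  smul_one g := map_one (SymmetricAlgebra.lift (SymmetricAlgebra.ι ℂ V ∘ₗ act V g))
  smul_mul g := map_mul (SymmetricAlgebra.lift (SymmetricAlgebra.ι ℂ V ∘ₗ act V g))

instance symAction_comm : SMulCommClass G ℂ (SymmetricAlgebra ℂ V) where
  smul_comm g r := map_smul (SymmetricAlgebra.lift (SymmetricAlgebra.ι ℂ V ∘ₗ act V g)) r

variable {V G} in
theorem smul_tensor_ι (g : G) (x : V) :
    g • TensorAlgebra.ι ℂ x = TensorAlgebra.ι ℂ (g • x) :=
  TensorAlgebra.lift_ι_apply _ _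

variable {V G} in
theorem smul_sym_ι (g : G) (x : V) :
    g • SymmetricAlgebra.ι ℂ V x = SymmetricAlgebra.ι ℂ V (g • x) :=
  SymmetricAlgebra.lift_ι_apply _ _

/-- `G ⋉ T(V)`: sums of elements `single g a` (that is, `a g`) with
`(a g) (b h) = (a (g • b)) (g h)`. -/
abbrev SmashTensor : Type _ := SkewMonoidAlgebra (TensorAlgebra ℂ V) G

/-- `G ⋉ S(V)`. -/
abbrev SmashSym : Type _ := SkewMonoidAlgebra (SymmetricAlgebra ℂ V) G

variable {V} in
/-- A vector, as an element of `G ⋉ T(V)`. -/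
def vec : V →ₗ[ℂ] SmashTensor V G := (SkewMonoidAlgebra.lsingle ℂ 1) ∘ₗ TensorAlgebra.ι ℂ

/-- The inclusion of the group algebra in `G ⋉ T(V)`. -/
def groupAlg : MonoidAlgebra ℂ G →ₐ[ℂ] SmashTensor V G :=
  MonoidAlgebra.lift ℂ (SmashTensor V G) G (SkewMonoidAlgebra.of (TensorAlgebra ℂ V) G)

end Smash

/-! ### The algebra `H_κ`, its filtration, and the natural map `ξ` -/

section Hkappa

variable {V G : Type*} [AddCommGroup V] [Module ℂ V] [Group G] [DistribMulAction G V]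
  [SMulCommClass G ℂ V] (κ : V →ₗ[ℂ] V →ₗ[ℂ] MonoidAlgebra ℂ G)

/-- The relations `[x, y] = κ(x, y)`. -/
inductive HRel : SmashTensor V G → SmashTensor V G → Prop
  | comm (x y : V) :
    HRel (vec G x * vec G y - vec G y * vec G x) (groupAlg V G (κ x y))

/-- The quotient `H_κ` of `G ⋉ T(V)` by the relations `[x, y] = κ(x, y)`. -/
def H : Type _ := RingQuot (HRel κ)

instance : Ring (H κ) := inferInstanceAs (Ring (RingQuot (HRel κ)))

instance : Algebra ℂ (H κ) := inferInstanceAs (Algebra ℂ (RingQuot (HRel κ)))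

/-- The projection `G ⋉ T(V) → H_κ`. -/
def proj : SmashTensor V G →ₐ[ℂ] H κ := RingQuot.mkAlgHom ℂ (HRel κ)

theorem proj_rel (x y : V) :
    proj κ (vec G x) * proj κ (vec G y) - proj κ (vec G y) * proj κ (vec G x) =
      proj κ (groupAlg V G (κ x y)) := by
  rw [← map_mul (proj κ), ← map_mul (proj κ), ← map_sub (proj κ)]
  exact RingQuot.mkAlgHom_rel ℂ (HRel.comm x y)

/-- The increasing filtration of `H_κ` with `deg V = 1`, `deg G = 0`: the `n`-th step is spanned
by the images of the `x₁ ⋯ x_k g` with `k ≤ n`, `x_i ∈ V`, `g ∈ G`. -/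
def filt (n : ℕ) : Submodule ℂ (H κ) :=
  Submodule.span ℂ {a | ∃ l : List V, l.length ≤ n ∧ ∃ g : G,
    a = (l.map fun x => proj κ (vec G x)).prod *
      proj κ (SkewMonoidAlgebra.of (TensorAlgebra ℂ V) G g)}

theorem filt_mono : Monotone (filt κ) := fun _ _ h =>
  Submodule.span_mono fun _ ⟨l, hl, g, e⟩ => ⟨l, hl.trans h, g, e⟩

theorem of_mul_vec (g : G) (x : V) :
    SkewMonoidAlgebra.of (TensorAlgebra ℂ V) G g * vec G x =
      vec G (g • x) * SkewMonoidAlgebra.of (TensorAlgebra ℂ V) G g := by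
  simp [vec, SkewMonoidAlgebra.lsingle_apply, SkewMonoidAlgebra.single_mul_single, smul_tensor_ι]

theorem of_mul_prod (g : G) (l : List V) :
    proj κ (SkewMonoidAlgebra.of (TensorAlgebra ℂ V) G g) *
        (l.map fun x => proj κ (vec G x)).prod =
      ((l.map (g • ·)).map fun x => proj κ (vec G x)).prod *
        proj κ (SkewMonoidAlgebra.of (TensorAlgebra ℂ V) G g) := by
  induction l with
  | nil => simp
  | cons x l ih =>
    simp only [List.map_cons, List.prod_cons]
    rw [← mul_assoc, ← map_mul, of_mul_vec, map_mul, mul_assoc, ih, mul_assoc]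

instance filt_graded : SetLike.GradedMonoid (filt κ) where
  one_mem := Submodule.subset_span ⟨[], le_rfl, 1, by simp⟩
  mul_mem := by
    intro i j a b ha hb
    have h : filt κ i * filt κ j ≤ filt κ (i + j) := by
      rw [filt, filt, Submodule.span_mul_span]
      refine Submodule.span_le.2 ?_
      rintro _ ⟨_, ⟨l, hl, g, rfl⟩, _, ⟨l', hl', g', rfl⟩, rfl⟩
      refine Submodule.subset_span ⟨l ++ l'.map (g • ·), ?_, g * g', ?_⟩
      · simpa using Nat.add_le_add hl hl'
      · simp only [List.map_append, List.prod_append, map_mul]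
        rw [mul_assoc, ← mul_assoc _ _ (proj κ _), of_mul_prod]
        simp only [mul_assoc]
    exact h (Submodule.mul_mem_mul ha hb)

theorem vec_mem (x : V) : proj κ (vec G x) ∈ filt κ 1 :=
  Submodule.subset_span ⟨[x], le_rfl, 1, by simp⟩

theorem of_mem (g : G) : proj κ (SkewMonoidAlgebra.of (TensorAlgebra ℂ V) G g) ∈ filt κ 0 :=
  Submodule.subset_span ⟨[], le_rfl, g, by simp⟩

theorem groupAlg_mem (a : MonoidAlgebra ℂ G) : proj κ (groupAlg V G a) ∈ filt κ 0 := by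
  induction a using MonoidAlgebra.induction_on with
  | of g => simpa [groupAlg] using of_mem κ g
  | add a b ha hb => simpa using add_mem ha hb
  | smul r a ha => simpa using Submodule.smul_mem _ r ha

/-- The associated graded algebra of `H_κ`. -/
abbrev GrH : Type _ := Gr (filt κ)

/-- The class of `V` in degree one of `gr H_κ`. -/
def grVec : V →ₗ[ℂ] GrH κ :=
  symbol (filt κ) 1 ∘ₗ ((proj κ).toLinearMap ∘ₗ vec G).codRestrict (filt κ 1) (vec_mem κ)

/-- The class of `G` in degree zero of `gr H_κ`. -/
def grGrp : G →* GrH κ where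
  toFun g := symbol (filt κ) 0 ⟨proj κ (SkewMonoidAlgebra.of (TensorAlgebra ℂ V) G g), of_mem κ g⟩
  map_one' := symbol_congr _ rfl (by simp)
  map_mul' g h := by
    rw [symbol_mul]
    refine symbol_congr _ rfl ?_
    change proj κ _ = proj κ _ * proj κ _
    rw [map_mul, map_mul]

theorem grVec_comm (x y : V) : grVec κ x * grVec κ y = grVec κ y * grVec κ x := by
  rw [← sub_eq_zero]
  simp only [grVec, LinearMap.comp_apply, symbol_mul]
  rw [← map_sub]
  refine symbol_eq_zero _ ?_
  change proj κ (vec G x) * proj κ (vec G y) - proj κ (vec G y) * proj κ (vec G x) ∈ filt κ 1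
  rw [proj_rel]
  exact filt_mono κ zero_le_one (groupAlg_mem κ _)

theorem grVec_smul_mul (g : G) (x : V) :
    grVec κ (g • x) * grGrp κ g = grGrp κ g * grVec κ x := by
  change symbol _ _ _ * symbol _ _ _ = symbol _ _ _ * symbol _ _ _
  rw [symbol_mul, symbol_mul]
  refine symbol_congr _ rfl ?_
  change proj κ (vec G (g • x)) * proj κ _ = proj κ _ * proj κ (vec G x)
  rw [← map_mul, ← map_mul, of_mul_vec]

/-- The algebra homomorphism from `S(V)` induced by a linear map with pairwise commuting values. -/
def symLift {B : Type*} [Ring B] [Algebra ℂ B] (f : V →ₗ[ℂ] B)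
    (hf : ∀ x y, f x * f y = f y * f x) : SymmetricAlgebra ℂ V →ₐ[ℂ] B :=
  RingCon.liftₐ (TensorAlgebra.symRingCon ℂ V) (TensorAlgebra.lift ℂ f) (by
    refine RingCon.ringConGen_le.2 ?_
    rintro _ _ ⟨x, y⟩
    rw [RingCon.ker_apply]
    simpa using hf x y)

theorem symLift_ι {B : Type*} [Ring B] [Algebra ℂ B] (f : V →ₗ[ℂ] B)
    (hf : ∀ x y, f x * f y = f y * f x) (x : V) :
    symLift f hf (SymmetricAlgebra.ι ℂ V x) = f x :=
  TensorAlgebra.lift_ι_apply f x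

theorem symLift_smul_mul (g : G) (a : SymmetricAlgebra ℂ V) :
    symLift (grVec κ) (grVec_comm κ) (g • a) * grGrp κ g =
      grGrp κ g * symLift (grVec κ) (grVec_comm κ) a := by
  induction a using SymmetricAlgebra.induction with
  | algebraMap r =>
    rw [smul_algebraMap, AlgHom.commutes, Algebra.commutes]
  | ι x => rw [smul_sym_ι, symLift_ι, symLift_ι, grVec_smul_mul]
  | mul a b ha hb => rw [smul_mul', map_mul, map_mul, mul_assoc, hb, ← mul_assoc, ha, mul_assoc]
  | add a b ha hb => rw [smul_add, map_add, map_add, add_mul, mul_add, ha, hb]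

/-- The natural homomorphism `ξ : G ⋉ S(V) → gr H_κ`, sending `x ∈ V` to its class in degree one
and `g ∈ G` to its class in degree zero. -/
def xi : SmashSym V G →ₐ[ℂ] GrH κ :=
  SkewMonoidAlgebra.liftNCAlgHom (symLift (grVec κ) (grVec_comm κ)) (grGrp κ)
    (fun {a g} => symLift_smul_mul κ g a)

theorem xi_vec (x : V) :
    xi κ (SkewMonoidAlgebra.single 1 (SymmetricAlgebra.ι ℂ V x)) = grVec κ x := by
  change SkewMonoidAlgebra.liftNC _ _ _ = _
  simp [symLift_ι]

theorem xi_grp (g : G) : xi κ (SkewMonoidAlgebra.single g 1) = grGrp κ g := by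
  change SkewMonoidAlgebra.liftNC _ _ _ = _
  simp

theorem xi_list (l : List V) : ∃ a, ∃ h : (l.map fun x => proj κ (vec G x)).prod ∈ filt κ l.length,
    xi κ a = symbol (filt κ) l.length ⟨_, h⟩ := by
  induction l with
  | nil => exact ⟨1, SetLike.one_mem_graded _, (map_one _).trans (symbol_one _).symm⟩
  | cons x l ih =>
    obtain ⟨a, h, e⟩ := ih
    have h2 := SetLike.mul_mem_graded (vec_mem κ x) h
    refine ⟨SkewMonoidAlgebra.single 1 (SymmetricAlgebra.ι ℂ V x) * a, by simpa [add_comm] using h2, ?_⟩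
    rw [map_mul, e, xi_vec]
    exact (symbol_mul (filt κ) ⟨_, vec_mem κ x⟩ ⟨_, h⟩).trans (symbol_congr _ (by simp [add_comm]) (by simp))

theorem xi_surjective : Function.Surjective (xi κ) := by
  rw [← AlgHom.range_eq_top, eq_top_iff]
  rintro z -
  induction z using DirectSum.induction_on with
  | zero => exact zero_mem _
  | add a b ha hb => exact add_mem ha hb
  | of n a =>
    obtain ⟨⟨a, ha⟩, rfl⟩ := grMk_surjective _ _ a
    change symbol (filt κ) n ⟨a, ha⟩ ∈ _
    induction ha using Submodule.span_induction with
    | zero =>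
      have : symbol (filt κ) n ⟨0, zero_mem _⟩ = 0 := map_zero _
      rw [this]; exact zero_mem _
    | add x y hx hy ihx ihy =>
      have := add_mem ihx ihy
      rwa [← map_add] at this
    | smul r x hx ih =>
      have := Subalgebra.smul_mem _ ih r
      rwa [← map_smul] at this
    | mem x hx =>
      obtain ⟨l, hl, g, rfl⟩ := hx
      rcases hl.lt_or_eq with hl | hl
      · rw [symbol_eq_zero]; exact zero_mem _
        cases n with
        | zero => simp at hl
        | succ n => exact Submodule.subset_span ⟨l, Nat.lt_succ_iff.1 hl, g, rfl⟩
      · obtain ⟨a, h, e⟩ := xi_list κ l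
        refine ⟨a * SkewMonoidAlgebra.single g 1, ?_⟩
        change xi κ _ = _
        rw [map_mul, e, xi_grp]
        exact (symbol_mul (filt κ) ⟨_, h⟩ ⟨_, of_mem κ g⟩).trans (symbol_congr _ (by simpa using hl) (by simp))

end Hkappa

/-! ### Symplectic reflections and the forms `ω_s` -/

section Reflections

variable (V : Type*) {G : Type*} [AddCommGroup V] [Module ℂ V] [Group G] [DistribMulAction G V]
  [SMulCommClass G ℂ V]

/-- The operator `1 - g` on `V`. -/
def oneSub (g : G) : V →ₗ[ℂ] V := LinearMap.id - act V g

variable (G) in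
/-- The set of symplectic reflections: the elements `s` such that `1 - s` has rank two on `V`. -/
def reflections : Set G := {s | Module.finrank ℂ (LinearMap.range (oneSub V s)) = 2}

variable [FiniteDimensional ℂ V] [Finite G]

theorem isCompl_oneSub (g : G) :
    IsCompl (LinearMap.range (oneSub V g)) (LinearMap.ker (oneSub V g)) := by
  refine (Submodule.isCompl_iff_disjoint _ _
    (LinearMap.finrank_range_add_finrank_ker _).ge).2 ?_
  rw [Submodule.disjoint_def]
  rintro _ ⟨x, rfl⟩ hy
  set y := oneSub V g x with hyd
  have hgx : g • x = x - y := by simp [hyd, oneSub]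
  have hgy : g • y = y := by
    have : y - g • y = 0 := by simpa [oneSub] using hy
    exact (sub_eq_zero.1 this).symm
  have hpow : ∀ k : ℕ, g ^ k • x = x - (k : ℂ) • y := by
    intro k
    induction k with
    | zero => simp
    | succ k ih =>
      rw [pow_succ', mul_smul, ih, smul_sub, smul_comm g, hgx, hgy]
      push_cast
      rw [add_smul, one_smul]
      abel
  have h := hpow (Nat.card G)
  rw [pow_card_eq_one', one_smul, eq_comm, sub_eq_self] at h
  exact (smul_eq_zero.1 h).resolve_left (Nat.cast_ne_zero.2 Nat.card_pos.ne')

variable {V}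

/-- The form `ω_s`: `ω` applied to the projections to the image of `1 - s` along its kernel. -/
def omegaS (ω : LinearMap.BilinForm ℂ V) (s : G) : LinearMap.BilinForm ℂ V :=
  ω.compl₁₂
    ((LinearMap.range (oneSub V s)).projection (LinearMap.ker (oneSub V s)) (isCompl_oneSub V s))
    ((LinearMap.range (oneSub V s)).projection (LinearMap.ker (oneSub V s)) (isCompl_oneSub V s))

end Reflections

end SymplecticReflection

end

/-! Both sides are equivalent to the Jacobi identity `SatisfiesJacobi`: the cyclic sum of the
commutators [κ(x, y), z] vanishes in G ⋉ T(V). Since `xi_surjective` holds for every κ, only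
injectivity of ξ is at stake.

In H_κ each κ(x, y) is a commutator, so the cyclic sum dies there. It is homogeneous of degree one,
so injectivity of ξ forces it to vanish already in G ⋉ S(V), and there the coefficients of the group
elements can be read off (`satisfiesJacobi_of_xi_injective`).

The converse is a Poincaré-Birkhoff-Witt argument with linear maps. A map on G ⋉ T(V) that kills the
relations up to degree N is modified in degree N + 1, where its change under a swap of neighbouring
letters is prescribed by κ. Such data integrate to a function of words when they respect the
relations of the symmetric group (`exists_potential`): alternation of κ gives the involutions, the
relations of lower degree give commuting distant swaps, and Jacobi gives the braid relation
(`KillsRelations.exists_extension`). Extending the projection to degree n of G ⋉ S(V) shows that a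
homogeneous element whose degree drops in H_κ is zero in G ⋉ S(V).

Finally the identity is solved one group element at a time. At g = 1 it is empty, and invariance
leaves a multiple of ω. At g ≠ 1 a nonzero solution forces 1 - g to have rank two and is a multiple
of ω_g (`eq_smul_omegaS_of_jacobi`); conversely ω_s is a solution because three vectors in a plane
are dependent (`omegaS_jacobi`). -/

noncomputable section

namespace SymplecticReflection

/-! ### Potentials on words -/

section Potential

variable {ι : Type*} [LinearOrder ι] {M : Type*} [AddCommGroup M]

/-- The number of inversions of a word. -/
def invCount : List ι → ℕ
  | [] => 0
  | a :: l => l.countP (· < a) + invCount l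

/-- This decrease makes sorting by adjacent swaps terminate; it is the measure for `potential` and
for the induction on confluence. -/
theorem invCount_swap_lt (u v : List ι) {i j : ι} (h : j < i) :
    invCount (u ++ j :: i :: v) < invCount (u ++ i :: j :: v) := by
  induction u with
  | nil => simp [invCount, h, h.not_gt]; omega
  | cons a u ih =>
    have hp : (u ++ j :: i :: v).Perm (u ++ i :: j :: v) :=
      (List.Perm.swap i j v).append_left u
    simp only [List.cons_append, invCount, hp.countP_eq]
    omega

/-- A descent of a word: a decomposition `u i j v` with `j < i`. -/
def IsDescent (w : List ι) (p : List ι × ι × ι × List ι) : Prop :=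
  w = p.1 ++ p.2.1 :: p.2.2.1 :: p.2.2.2 ∧ p.2.2.1 < p.2.1

open Classical in
/-- The sum of the values of the swaps along a chosen path from a word to a sorted word. -/
def potential (f : List ι → ι → ι → List ι → M) (w : List ι) : M :=
  if h : ∃ p, IsDescent w p then
    potential f (h.choose.1 ++ h.choose.2.2.1 :: h.choose.2.1 :: h.choose.2.2.2) +
      f h.choose.1 h.choose.2.1 h.choose.2.2.1 h.choose.2.2.2
  else 0
termination_by invCount w
decreasing_by
  have hs := h.choose_spec
  conv_rhs => rw [hs.1]
  exact invCount_swap_lt _ _ hs.2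

theorem exists_potential_eq (f : List ι → ι → ι → List ι → M) {w : List ι}
    (h : ∃ p, IsDescent w p) : ∃ u i j v, w = u ++ i :: j :: v ∧ j < i ∧
      potential f w = potential f (u ++ j :: i :: v) + f u i j v := by
  refine ⟨h.choose.1, h.choose.2.1, h.choose.2.2.1, h.choose.2.2.2, h.choose_spec.1,
    h.choose_spec.2, ?_⟩
  rw [potential, dif_pos h]

variable {f : List ι → ι → ι → List ι → M}

/-- Two swaps of the same word lead to the same value, when smaller words behave well. -/
theorem potential_confluent
    (far : ∀ u i j v k l w, f u i j (v ++ k :: l :: w) + f (u ++ j :: i :: v) k l w =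
      f (u ++ i :: j :: v) k l w + f u i j (v ++ l :: k :: w))
    (braid : ∀ u i j k v, f u i j (k :: v) + f (u ++ [j]) i k v + f u j k (i :: v) =
      f (u ++ [i]) j k v + f u i k (j :: v) + f (u ++ [k]) i j v)
    {w : List ι}
    (ih : ∀ u i j v, j < i → invCount (u ++ i :: j :: v) < invCount w →
      potential f (u ++ i :: j :: v) = potential f (u ++ j :: i :: v) + f u i j v)
    {u v u' v' : List ι} {i j i' j' : ι} (h : w = u ++ i :: j :: v) (hij : j < i)
    (h' : w = u' ++ i' :: j' :: v') (hij' : j' < i') (hl : u.length ≤ u'.length) :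
    potential f (u ++ j :: i :: v) + f u i j v =
      potential f (u' ++ j' :: i' :: v') + f u' i' j' v' := by
  have e := h.symm.trans h'
  obtain ⟨t, rfl, ht⟩ : ∃ t, u' = u ++ t ∧ i :: j :: v = t ++ i' :: j' :: v' := by
    rcases List.append_eq_append_iff.1 e with ⟨t, h1, h2⟩ | ⟨t, h1, h2⟩
    · exact ⟨t, h1, h2⟩
    · have : t = [] := by
        have := congrArg List.length h1
        simp at this
        exact List.length_eq_zero_iff.1 (by omega)
      subst this
      exact ⟨[], by simpa using h1.symm, by simpa using h2.symm⟩
  -- `t` is the gap between the two descents: they coincide, overlap in one letter, or are disjoint.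
  match t, ht with
  | [], ht =>
    simp only [List.nil_append, List.cons.injEq] at ht
    obtain ⟨rfl, rfl, rfl⟩ := ht
    simp
  | [a], ht =>
    simp only [List.cons_append, List.nil_append, List.cons.injEq] at ht
    obtain ⟨rfl, rfl, rfl⟩ := ht
    subst h
    -- The word contains i > j > j'. Both ways of reversing these three letters form a hexagon, and
    -- `braid` says that the two sides have the same total.
    have l1 := invCount_swap_lt u (j' :: v') hij
    have l2 := invCount_swap_lt (u ++ [j]) v' (hij'.trans hij)
    have l3 := invCount_swap_lt (u ++ [i]) v' hij'
    have l4 := invCount_swap_lt u (j :: v') (hij'.trans hij)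
    have e1 := ih (u ++ [j]) i j' v' (hij'.trans hij) (by simpa using l1)
    have e2 := ih u j j' (i :: v') hij' (by simp at *; omega)
    have e3 := ih u i j' (j :: v') (hij'.trans hij) (by simpa using l3)
    have e4 := ih (u ++ [j']) i j v' hij (by simp at *; omega)
    have b := braid u i j j' v'
    simp only [List.append_assoc, List.cons_append, List.nil_append] at e1 e2 e3 e4 ⊢
    rw [e1, e2, e3, e4]
    rw [← sub_eq_zero] at b ⊢
    rw [← b]
    abel
  | a :: b :: t, ht =>
    simp only [List.cons_append, List.cons.injEq] at ht
    obtain ⟨rfl, rfl, rfl⟩ := ht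
    subst h
    -- Disjoint swaps form a square, closed by `far`.
    have l1 := invCount_swap_lt u (t ++ i' :: j' :: v') hij
    have l2 := invCount_swap_lt (u ++ i :: j :: t) v' hij'
    have e1 := ih (u ++ j :: i :: t) i' j' v' hij' (by simpa using l1)
    have e2 := ih u i j (t ++ j' :: i' :: v') hij (by simpa using l2)
    have b := far u i j t i' j' v'
    simp only [List.append_assoc, List.cons_append] at e1 e2 b ⊢
    rw [e1, e2]
    rw [← sub_eq_zero] at b ⊢
    rw [← b]
    abel

/-- Strong induction on inversions: the descent chosen by `potential` and the given one are two
swaps of the same word, so `potential_confluent` applies in whichever order they occur. -/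
theorem potential_swap_of_lt
    (far : ∀ u i j v k l w, f u i j (v ++ k :: l :: w) + f (u ++ j :: i :: v) k l w =
      f (u ++ i :: j :: v) k l w + f u i j (v ++ l :: k :: w))
    (braid : ∀ u i j k v, f u i j (k :: v) + f (u ++ [j]) i k v + f u j k (i :: v) =
      f (u ++ [i]) j k v + f u i k (j :: v) + f (u ++ [k]) i j v)
    (u : List ι) (i j : ι) (v : List ι) (hij : j < i) :
    potential f (u ++ i :: j :: v) = potential f (u ++ j :: i :: v) + f u i j v := by
  obtain ⟨n, hn⟩ : ∃ n, invCount (u ++ i :: j :: v) = n := ⟨_, rfl⟩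
  induction n using Nat.strong_induction_on generalizing u i j v with
  | _ n IH =>
    have ih : ∀ u' i' j' v', j' < i' →
        invCount (u' ++ i' :: j' :: v') < invCount (u ++ i :: j :: v) →
        potential f (u' ++ i' :: j' :: v') = potential f (u' ++ j' :: i' :: v') + f u' i' j' v' :=
      fun u' i' j' v' h hlt => IH _ (hn ▸ hlt) u' i' j' v' h rfl
    obtain ⟨u', i', j', v', h', hij', e⟩ :=
      exists_potential_eq f (w := u ++ i :: j :: v) ⟨(u, i, j, v), rfl, hij⟩
    rw [e]
    rcases le_total u.length u'.length with hl | hl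
    · exact (potential_confluent far braid ih rfl hij h' hij' hl).symm
    · exact potential_confluent far braid ih h' hij' rfl hij hl

/-- A function of swaps of words that satisfies the relations of the symmetric groups is the
coboundary of a function of words. -/
theorem exists_potential
    (self : ∀ u i v, f u i i v = 0) (anti : ∀ u i j v, f u i j v = -f u j i v)
    (far : ∀ u i j v k l w, f u i j (v ++ k :: l :: w) + f (u ++ j :: i :: v) k l w =
      f (u ++ i :: j :: v) k l w + f u i j (v ++ l :: k :: w))
    (braid : ∀ u i j k v, f u i j (k :: v) + f (u ++ [j]) i k v + f u j k (i :: v) =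
      f (u ++ [i]) j k v + f u i k (j :: v) + f (u ++ [k]) i j v) :
    ∃ ψ : List ι → M, ∀ u i j v,
      ψ (u ++ i :: j :: v) = ψ (u ++ j :: i :: v) + f u i j v := by
  refine ⟨potential f, fun u i j v => ?_⟩
  rcases lt_trichotomy i j with h | rfl | h
  · rw [potential_swap_of_lt far braid u j i v h, anti u i j v]
    abel
  · simp [self]
  · exact potential_swap_of_lt far braid u i j v h

end Potential

/-! ### The grading of `G ⋉ T(V)` -/

section Grading

variable {V G : Type*} [AddCommGroup V] [Module ℂ V] [Group G] [DistribMulAction G V]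
  [SMulCommClass G ℂ V]

variable (G) in
/-- The product of a list of vectors in `G ⋉ T(V)`. -/
def word (l : List V) : SmashTensor V G := (l.map (vec G)).prod

variable (V) in
/-- A group element, as an element of `G ⋉ T(V)`. -/
abbrev grp : G →* SmashTensor V G := SkewMonoidAlgebra.of (TensorAlgebra ℂ V) G

@[simp] theorem word_nil : word G ([] : List V) = 1 := rfl

@[simp] theorem word_cons (x : V) (l : List V) : word G (x :: l) = vec G x * word G l := by
  simp [word]

@[simp] theorem word_append (l l' : List V) : word G (l ++ l') = word G l * word G l' := by
  simp [word]

theorem grp_mul_word (g : G) (l : List V) :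
    grp V g * word G l = word G (l.map (g • ·)) * grp V g := by
  induction l with
  | nil => simp
  | cons x l ih =>
    rw [word_cons, ← mul_assoc, of_mul_vec, mul_assoc, ih, List.map_cons, word_cons, mul_assoc]

variable (V G) in
/-- The span of the elements `x₁ ⋯ x_k g`, the component of degree `k` of `G ⋉ T(V)`. -/
def grade (k : ℕ) : Submodule ℂ (SmashTensor V G) :=
  Submodule.span ℂ {a | ∃ l : List V, l.length = k ∧ ∃ g : G, a = word G l * grp V g}

theorem word_mul_grp_mem (l : List V) (g : G) : word G l * grp V g ∈ grade V G l.length :=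
  Submodule.subset_span ⟨l, rfl, g, rfl⟩

theorem word_mem (l : List V) : word G l ∈ grade V G l.length := by
  simpa using word_mul_grp_mem l (1 : G)

theorem grp_mem (g : G) : grp V g ∈ grade V G 0 := by
  simpa using word_mul_grp_mem ([] : List V) g

theorem groupAlg_mem_grade (a : MonoidAlgebra ℂ G) : groupAlg V G a ∈ grade V G 0 := by
  induction a using MonoidAlgebra.induction_on with
  | of g => simpa [groupAlg] using grp_mem g
  | add a b ha hb => simpa using add_mem ha hb
  | smul r a ha => simpa using Submodule.smul_mem _ r ha

theorem mul_mem_grade {i j : ℕ} {a c : SmashTensor V G} (ha : a ∈ grade V G i)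
    (hc : c ∈ grade V G j) : a * c ∈ grade V G (i + j) := by
  have h : grade V G i * grade V G j ≤ grade V G (i + j) := by
    rw [grade, grade, Submodule.span_mul_span]
    refine Submodule.span_le.2 ?_
    rintro _ ⟨_, ⟨l, rfl, g, rfl⟩, _, ⟨l', rfl, g', rfl⟩, rfl⟩
    refine Submodule.subset_span ⟨l ++ l'.map (g • ·), by simp, g * g', ?_⟩
    change word G l * grp V g * (word G l' * grp V g') = _
    rw [mul_assoc, ← mul_assoc (grp V g), grp_mul_word, word_append, map_mul]
    simp only [mul_assoc]
  exact h (Submodule.mul_mem_mul ha hc)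

/-! ### Words in the vectors of a basis -/

section Basis

variable {ι : Type*} (b : Module.Basis ι ℂ V)

theorem tensorAlgebra_basis_apply (w : List ι) :
    b.tensorAlgebra (FreeMonoid.ofList w) = (w.map fun i => TensorAlgebra.ι ℂ (b i)).prod := by
  have h : FreeAlgebra.basisFreeMonoid ℂ ι (FreeMonoid.ofList w) =
      FreeMonoid.lift (FreeAlgebra.ι ℂ) (FreeMonoid.ofList w) := by
    simp only [FreeAlgebra.basisFreeMonoid, Module.Basis.map_apply, Finsupp.coe_basisSingleOne]
    change MonoidAlgebra.lift ℂ (FreeAlgebra ℂ ι) (FreeMonoid ι) (FreeMonoid.lift (FreeAlgebra.ι ℂ))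
      (MonoidAlgebra.single _ 1) = _
    rw [MonoidAlgebra.lift_single, one_smul]
  simp only [Module.Basis.tensorAlgebra, Module.Basis.map_apply, h, FreeMonoid.lift_ofList]
  change (TensorAlgebra.equivFreeAlgebra b).symm _ = _
  simp [map_list_prod, Function.comp_def]

/-- Basis words times group elements are thus the standard ℂ-basis of G ⋉ T(V), on which a linear
map may be prescribed freely. -/
theorem word_map_basis_mul_grp (w : List ι) (g : G) :
    word G (w.map b) * grp V g =
      SkewMonoidAlgebra.single g (b.tensorAlgebra (FreeMonoid.ofList w)) := by
  have h : word G (w.map b) =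
      SkewMonoidAlgebra.single 1 (b.tensorAlgebra (FreeMonoid.ofList w)) := by
    rw [tensorAlgebra_basis_apply]
    induction w with
    | nil => rfl
    | cons i w ih =>
      rw [List.map_cons, word_cons, ih]
      simp [vec, SkewMonoidAlgebra.lsingle_apply, SkewMonoidAlgebra.single_mul_single]
  rw [h]
  simp [SkewMonoidAlgebra.single_mul_single]

/-- A linear map on `G ⋉ T(V)` with given values on the products of basis vectors and group
elements. -/
theorem exists_linearMap_word {M : Type*} [AddCommGroup M] [Module ℂ M] (φ : List ι → G → M) :
    ∃ Φ : SmashTensor V G →ₗ[ℂ] M, ∀ w g, Φ (word G (w.map b) * grp V g) = φ w g := by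
  refine ⟨(Finsupp.lsum ℂ fun g => b.tensorAlgebra.constr ℂ fun w =>
    φ (FreeMonoid.toList w) g) ∘ₗ
      (SkewMonoidAlgebra.coeffLinearEquiv (S := ℂ)).toLinearMap, fun w g => ?_⟩
  rw [word_map_basis_mul_grp]
  have : SkewMonoidAlgebra.coeffLinearEquiv (S := ℂ) (SkewMonoidAlgebra.single g
    (b.tensorAlgebra (FreeMonoid.ofList w))) = Finsupp.single g
    (b.tensorAlgebra (FreeMonoid.ofList w)) := rfl
  simp [this]

theorem word_mem_span_basis (l : List V) :
    word G l ∈ Submodule.span ℂ {a | ∃ w : List ι, w.length = l.length ∧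
      a = word G (w.map b)} := by
  induction l with
  | nil => exact Submodule.subset_span ⟨[], rfl, rfl⟩
  | cons x l ih =>
    have hx : vec G x ∈ Submodule.span ℂ (Set.range fun i => vec G (b i)) := by
      have := Submodule.mem_map_of_mem (f := vec G) (b.mem_span x)
      rw [Submodule.map_span, ← Set.range_comp] at this
      exact this
    have := Submodule.mul_mem_mul hx ih
    rw [Submodule.span_mul_span] at this
    rw [word_cons]
    refine Submodule.span_mono ?_ this
    rintro _ ⟨_, ⟨i, rfl⟩, _, ⟨w, hw, rfl⟩, rfl⟩
    exact ⟨i :: w, by simp [hw], by simp⟩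

theorem grade_le_span_basis (k : ℕ) :
    grade V G k ≤ Submodule.span ℂ {a | ∃ w : List ι, w.length = k ∧ ∃ g : G,
      a = word G (w.map b) * grp V g} := by
  refine Submodule.span_le.2 ?_
  rintro _ ⟨l, rfl, g, rfl⟩
  have := Submodule.mem_map_of_mem (f := LinearMap.mulRight ℂ (grp V g))
    (word_mem_span_basis (G := G) b l)
  rw [Submodule.map_span] at this
  refine Submodule.span_mono ?_ this
  rintro _ ⟨_, ⟨w, hw, rfl⟩, rfl⟩
  exact ⟨w, hw, g, rfl⟩

end Basis

theorem iSup_grade [FiniteDimensional ℂ V] : ⨆ k, grade V G k = ⊤ := by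
  have b := Module.finBasis ℂ V
  have h : ∀ g : G, ∀ a : TensorAlgebra ℂ V,
      SkewMonoidAlgebra.single g a ∈ ⨆ k, grade V G k := by
    intro g a
    have : ⊤ ≤ (⨆ k, grade V G k).comap (SkewMonoidAlgebra.lsingle ℂ g) := by
      rw [← b.tensorAlgebra.span_eq, Submodule.span_le]
      rintro _ ⟨w, rfl⟩
      have h := word_map_basis_mul_grp b (FreeMonoid.toList w) g
      rw [FreeMonoid.ofList_toList] at h
      change SkewMonoidAlgebra.single g (b.tensorAlgebra w) ∈ ⨆ k, grade V G k
      rw [← h]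
      exact Submodule.mem_iSup_of_mem (p := grade V G) _ (word_mul_grp_mem _ g)
    exact this (Submodule.mem_top (x := a))
  refine eq_top_iff.2 fun a _ => ?_
  induction a using SkewMonoidAlgebra.induction_on with
  | zero => exact Submodule.zero_mem _
  | single g a => exact h g a
  | add a c ha hc => exact add_mem (ha trivial) (hc trivial)

end Grading

/-! ### Extending functionals that vanish on the relations -/

section Extension

variable {V G : Type*} [AddCommGroup V] [Module ℂ V] [Group G] [DistribMulAction G V]
  [SMulCommClass G ℂ V] (κ : V →ₗ[ℂ] V →ₗ[ℂ] MonoidAlgebra ℂ G)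

/-- The relator `[x, y] - κ(x, y)`. -/
def relator : V →ₗ[ℂ] V →ₗ[ℂ] SmashTensor V G :=
  LinearMap.mk₂ ℂ (fun x y => vec G x * vec G y - vec G y * vec G x - groupAlg V G (κ x y))
    (fun x x' y => by simp only [map_add, add_mul, mul_add, LinearMap.add_apply]; abel)
    (fun r x y => by
      simp only [map_smul, smul_mul_assoc, mul_smul_comm, smul_sub,
        LinearMap.smul_apply])
    (fun x y y' => by simp only [map_add, add_mul, mul_add]; abel)
    (fun r x y => by
      simp only [map_smul, smul_mul_assoc, mul_smul_comm, smul_sub])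

theorem relator_apply (x y : V) :
    relator κ x y = vec G x * vec G y - vec G y * vec G x - groupAlg V G (κ x y) := rfl

/-- Equivariance of `κ` for the conjugation action. -/
def IsEquivariant : Prop := ∀ (g : G) (x y : V),
  κ (g • x) (g • y) = MonoidAlgebra.of ℂ G g * κ x y * MonoidAlgebra.of ℂ G g⁻¹

/-- The Jacobi identity `[κ(x, y), z] + [κ(y, z), x] + [κ(z, x), y] = 0`, in components. -/
def SatisfiesJacobi : Prop := ∀ (g : G) (x y z : V),
  (κ x y).coeff g • (g • z - z) + (κ y z).coeff g • (g • x - x) +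
    (κ z x).coeff g • (g • y - y) = 0

theorem groupAlg_of (g : G) : groupAlg V G (MonoidAlgebra.of ℂ G g) = grp V g := by
  simp [groupAlg]

variable {κ}

/-- Group elements pass through relators, so it suffices to test relations multiplied by words, with
a single group element at the right end. -/
theorem IsEquivariant.grp_mul_relator (h : IsEquivariant κ) (g : G) (x y : V) :
    grp V g * relator κ x y = relator κ (g • x) (g • y) * grp V g := by
  have e : groupAlg V G (κ (g • x) (g • y)) * grp V g = grp V g * groupAlg V G (κ x y) := by
    rw [h g x y, map_mul, map_mul, groupAlg_of, groupAlg_of, mul_assoc, mul_assoc, ← map_mul]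
    simp
  rw [relator_apply, relator_apply, sub_mul, e, mul_sub, mul_sub, sub_mul]
  simp only [mul_assoc, ← of_mul_vec]
  simp only [← mul_assoc, ← of_mul_vec]

theorem groupAlg_eq_sum [Fintype G] (a : MonoidAlgebra ℂ G) :
    groupAlg V G a = ∑ g, a.coeff g • grp V g := by
  conv_lhs => rw [← MonoidAlgebra.sum_coeff_single a, Finsupp.sum_fintype _ _ (by simp)]
  simp [map_sum, groupAlg]

/-- Because g z = g(z) g, the commutator has component g(z) - z at g; this is where the form of
`SatisfiesJacobi` comes from. -/
theorem groupAlg_commutator [Fintype G] (a : MonoidAlgebra ℂ G) (z : V) :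
    groupAlg V G a * vec G z - vec G z * groupAlg V G a =
      ∑ g, vec G (a.coeff g • (g • z - z)) * grp V g := by
  rw [groupAlg_eq_sum, Finset.sum_mul, Finset.mul_sum, ← Finset.sum_sub_distrib]
  refine Finset.sum_congr rfl fun g _ => ?_
  rw [smul_mul_assoc, mul_smul_comm, of_mul_vec, LinearMap.map_smul, map_sub,
    smul_mul_assoc, sub_mul, smul_sub]

theorem SatisfiesJacobi.commutator [Finite G] (h : SatisfiesJacobi κ) (x y z : V) :
    (groupAlg V G (κ x y) * vec G z - vec G z * groupAlg V G (κ x y)) +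
      (groupAlg V G (κ y z) * vec G x - vec G x * groupAlg V G (κ y z)) +
      (groupAlg V G (κ z x) * vec G y - vec G y * groupAlg V G (κ z x)) = 0 := by
  cases nonempty_fintype G
  simp only [groupAlg_commutator, ← Finset.sum_add_distrib, ← add_mul, ← map_add]
  refine Finset.sum_eq_zero fun g _ => ?_
  rw [h g x y z, map_zero, zero_mul]

variable {M : Type*} [AddCommGroup M] [Module ℂ M]

variable (κ) in
/-- A linear map on `G ⋉ T(V)` vanishes on the relations of degree at most `N`. -/
def KillsRelations (Φ : SmashTensor V G →ₗ[ℂ] M) (N : ℕ) : Prop :=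
  ∀ i j, i + j + 2 ≤ N → ∀ a ∈ grade V G i, ∀ c ∈ grade V G j, ∀ x y : V,
    Φ (a * relator κ x y * c) = 0

theorem map_relator_eq_zero_of_basis {ι : Type*} (b : Module.Basis ι ℂ V)
    (hκ : IsEquivariant κ) {Φ : SmashTensor V G →ₗ[ℂ] M} {n : ℕ}
    (h : ∀ (u v : List ι) (i j : ι) (g : G), u.length + v.length + 2 = n →
      Φ (word G (u.map b) * relator κ (b i) (b j) * (word G (v.map b) * grp V g)) = 0)
    {i j : ℕ} (hij : i + j + 2 = n) {a c : SmashTensor V G} (ha : a ∈ grade V G i)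
    (hc : c ∈ grade V G j) (x y : V) : Φ (a * relator κ x y * c) = 0 := by
  have h1 : ∀ (u : List ι) (x y : V) (c : SmashTensor V G), u.length = i → c ∈ grade V G j →
      Φ (word G (u.map b) * relator κ x y * c) = 0 := by
    intro u x y c hu hc
    have : Submodule.span ℂ {a | ∃ w : List ι, w.length = j ∧ ∃ g : G,
        a = word G (w.map b) * grp V g} ≤
        LinearMap.ker (Φ ∘ₗ LinearMap.mulLeft ℂ (word G (u.map b) * relator κ x y)) := by
      refine Submodule.span_le.2 ?_
      rintro _ ⟨v, hv, g, rfl⟩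
      have : (relator κ).compr₂ (Φ ∘ₗ LinearMap.mulRight ℂ (word G (v.map b) * grp V g) ∘ₗ
          LinearMap.mulLeft ℂ (word G (u.map b))) = 0 :=
        LinearMap.ext_basis b b fun k l => h u v k l g (by omega)
      exact LinearMap.congr_fun₂ this x y
    exact this (grade_le_span_basis b j hc)
  have : Submodule.span ℂ {a | ∃ w : List ι, w.length = i ∧ ∃ g : G,
      a = word G (w.map b) * grp V g} ≤
      LinearMap.ker (Φ ∘ₗ LinearMap.mulRight ℂ (relator κ x y * c)) := by
    refine Submodule.span_le.2 ?_
    rintro _ ⟨u, hu, g, rfl⟩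
    have := h1 u (g • x) (g • y) (grp V g * c) hu (by simpa using mul_mem_grade (grp_mem g) hc)
    change Φ (word G (u.map b) * grp V g * (relator κ x y * c)) = 0
    rw [← this, ← mul_assoc, mul_assoc (word G _), hκ.grp_mul_relator]
    simp only [mul_assoc]
  rw [mul_assoc]
  exact this (grade_le_span_basis b i ha)

theorem KillsRelations.eq_of_swap {Φ : SmashTensor V G →ₗ[ℂ] M} {N : ℕ}
    (hΦ : KillsRelations κ Φ N) {i j : ℕ} (hij : i + j + 2 ≤ N) {a c : SmashTensor V G}
    (ha : a ∈ grade V G i) (hc : c ∈ grade V G j) (x y : V) :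
    Φ (a * (vec G x * (vec G y * c))) =
      Φ (a * (vec G y * (vec G x * c))) + Φ (a * (groupAlg V G (κ x y) * c)) := by
  have h := hΦ i j hij a ha c hc x y
  rw [relator_apply, mul_sub, mul_sub, sub_mul, sub_mul, map_sub, map_sub, sub_sub,
    sub_eq_zero] at h
  simpa only [mul_assoc] using h

theorem map_groupAlg_neg (Φ : SmashTensor V G →ₗ[ℂ] M) (a c : SmashTensor V G)
    (k : MonoidAlgebra ℂ G) :
    Φ (a * (groupAlg V G (-k) * c)) = -Φ (a * (groupAlg V G k * c)) :=
  map_neg (Φ ∘ₗ LinearMap.mulLeft ℂ a ∘ₗ LinearMap.mulRight ℂ c ∘ₗ (groupAlg V G).toLinearMap) k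

/-- The six κ terms met along the two sides of the hexagon for x y z pair off into three
commutators, whose sum is the Jacobi sum; κ(x, z) = -κ(z, x) adjusts the signs. -/
theorem SatisfiesJacobi.map_braid [Finite G] (hJ : SatisfiesJacobi κ) (hκ_alt : κ.IsAlt)
    (Φ : SmashTensor V G →ₗ[ℂ] M) (a c : SmashTensor V G) (x y z : V) :
    Φ (a * (groupAlg V G (κ x y) * (vec G z * c))) +
        Φ (a * (vec G y * (groupAlg V G (κ x z) * c))) +
        Φ (a * (groupAlg V G (κ y z) * (vec G x * c))) =
      Φ (a * (vec G x * (groupAlg V G (κ y z) * c))) +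
        Φ (a * (groupAlg V G (κ x z) * (vec G y * c))) +
        Φ (a * (vec G z * (groupAlg V G (κ x y) * c))) := by
  have hc := congrArg (fun r => Φ (a * (r * c))) (hJ.commutator x y z)
  simp only [add_mul, sub_mul, mul_add, mul_sub, map_add, map_sub, zero_mul, mul_zero, map_zero,
    mul_assoc] at hc
  have h1 := map_groupAlg_neg Φ (a * vec G y) c (κ z x)
  have h2 := map_groupAlg_neg Φ a (vec G y * c) (κ z x)
  simp only [mul_assoc] at h1 h2
  rw [← hκ_alt.neg z x, h1, h2, ← sub_eq_zero, ← hc]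
  abel

/-- The κ term of a relation of degree N + 1 lies in degree N - 1, where `Φ` is already fixed. It
remains to integrate these values over swaps of words. -/
theorem KillsRelations.exists_extension_values [Finite G] {ι : Type*} [LinearOrder ι]
    (b : Module.Basis ι ℂ V) (hκ_alt : κ.IsAlt) (hJ : SatisfiesJacobi κ)
    {Φ : SmashTensor V G →ₗ[ℂ] M} {N : ℕ} (hΦ : KillsRelations κ Φ N) (g : G) :
    ∃ ψ : List ι → M, ∀ u i j v, u.length + v.length + 2 = N + 1 →
      ψ (u ++ i :: j :: v) = ψ (u ++ j :: i :: v) +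
        Φ (word G (u.map b) * (groupAlg V G (κ (b i) (b j)) * (word G (v.map b) * grp V g))) := by
  -- Swaps preserve length, so a cutoff by length is harmless and makes the compatibilities hold for
  -- all words.
  let f : List ι → ι → ι → List ι → M := fun u i j v =>
    if u.length + v.length + 2 = N + 1 then
      Φ (word G (u.map b) * (groupAlg V G (κ (b i) (b j)) * (word G (v.map b) * grp V g)))
    else 0
  obtain ⟨ψ, hψ⟩ : ∃ ψ : List ι → M, ∀ u i j v,
      ψ (u ++ i :: j :: v) = ψ (u ++ j :: i :: v) + f u i j v := by
    refine exists_potential ?_ ?_ ?_ ?_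
    · intro u i v
      simp [f, hκ_alt (b i)]
    · intro u i j v
      simp only [f, ← hκ_alt.neg (b i) (b j), map_groupAlg_neg]
      split_ifs <;> simp only [neg_neg, neg_zero]
    · intro u i j v k l w
      by_cases h : u.length + v.length + w.length + 4 = N + 1
      · have h1 := hΦ.eq_of_swap (a := word G (u.map b) * (groupAlg V G (κ (b i) (b j)) *
          word G (v.map b))) (c := word G (w.map b) * grp V g) (i := u.length + (0 + v.length))
          (j := w.length) (by omega)
          (mul_mem_grade (by simpa using word_mem (G := G) (u.map b))
            (mul_mem_grade (groupAlg_mem_grade _) (by simpa using word_mem (G := G) (v.map b))))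
          (by simpa using word_mul_grp_mem (w.map b) g) (b k) (b l)
        have h2 := hΦ.eq_of_swap (a := word G (u.map b))
          (c := word G (v.map b) * (groupAlg V G (κ (b k) (b l)) * (word G (w.map b) * grp V g)))
          (i := u.length) (j := v.length + (0 + w.length)) (by omega)
          (by simpa using word_mem (G := G) (u.map b))
          (mul_mem_grade (by simpa using word_mem (G := G) (v.map b))
            (mul_mem_grade (groupAlg_mem_grade _) (by simpa using word_mul_grp_mem (w.map b) g)))
          (b i) (b j)
        simp only [f, List.length_append, List.length_cons]
        rw [if_pos (by omega), if_pos (by omega), if_pos (by omega), if_pos (by omega)]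
        simp only [List.map_append, List.map_cons, word_append, word_cons, mul_assoc] at h1 h2 ⊢
        rw [h1, h2]
        abel
      · simp only [f, List.length_append, List.length_cons]
        rw [if_neg (by omega), if_neg (by omega), if_neg (by omega), if_neg (by omega)]
    · intro u i j k v
      by_cases h : u.length + v.length + 3 = N + 1
      · simp only [f, List.length_append, List.length_cons, List.length_nil]
        rw [if_pos (by omega), if_pos (by omega), if_pos (by omega), if_pos (by omega),
          if_pos (by omega), if_pos (by omega)]
        simp only [List.map_append, List.map_cons, List.map_nil, word_append, word_cons, word_nil,
          mul_one, mul_assoc]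
        exact hJ.map_braid hκ_alt Φ _ _ _ _ _
      · simp only [f, List.length_append, List.length_cons, List.length_nil]
        rw [if_neg (by omega), if_neg (by omega), if_neg (by omega), if_neg (by omega),
          if_neg (by omega), if_neg (by omega)]
  refine ⟨ψ, fun u i j v h => ?_⟩
  rw [hψ]
  simp only [f, if_pos h]

variable [FiniteDimensional ℂ V] [Finite G]

theorem KillsRelations.exists_extension (hκ_alt : κ.IsAlt) (hκ : IsEquivariant κ)
    (hJ : SatisfiesJacobi κ) {Φ : SmashTensor V G →ₗ[ℂ] M} {N : ℕ} (hΦ : KillsRelations κ Φ N) :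
    ∃ Φ' : SmashTensor V G →ₗ[ℂ] M, KillsRelations κ Φ' (N + 1) ∧
      ∀ k ≤ N, ∀ a ∈ grade V G k, Φ' a = Φ a := by
  have b := Module.finBasis ℂ V
  choose ψ hψ using fun g : G => hΦ.exists_extension_values b hκ_alt hJ g
  obtain ⟨Φ', hΦ'⟩ := exists_linearMap_word b fun w g =>
    -- Only degree N + 1 changes, so the relations of degree at most N survive.
    if w.length = N + 1 then ψ g w else Φ (word G (w.map b) * grp V g)
  have hagree : ∀ k ≤ N, ∀ a ∈ grade V G k, Φ' a = Φ a := by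
    intro k hk a ha
    have : Submodule.span ℂ {a | ∃ w : List (Fin (Module.finrank ℂ V)), w.length = k ∧ ∃ g : G,
        a = word G (w.map b) * grp V g} ≤ LinearMap.eqLocus Φ' Φ := by
      refine Submodule.span_le.2 ?_
      rintro _ ⟨w, hw, g, rfl⟩
      exact (hΦ' w g).trans (if_neg (by omega))
    exact this (grade_le_span_basis b k ha)
  refine ⟨Φ', fun i j hij a ha c hc x y => ?_, hagree⟩
  rcases hij.lt_or_eq with hlt | heq
  · have hle : i + j + 2 ≤ N := by omega
    rw [relator_apply, mul_sub, mul_sub, sub_mul, sub_mul, map_sub, map_sub]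
    have h2 : ∀ x y : V, Φ' (a * (vec G x * vec G y) * c) = Φ (a * (vec G x * vec G y) * c) :=
      fun x y => hagree (i + 2 + j) (by omega) _
        (mul_mem_grade (mul_mem_grade ha (by simpa using word_mem (G := G) [x, y])) hc)
    rw [h2, h2, hagree (i + 0 + j) (by omega) _
      (mul_mem_grade (mul_mem_grade ha (groupAlg_mem_grade _)) hc), ← map_sub, ← map_sub,
      ← sub_mul, ← sub_mul, ← mul_sub, ← mul_sub]
    exact hΦ i j hle a ha c hc x y
  · refine map_relator_eq_zero_of_basis b hκ (fun u v k l g h => ?_) heq ha hc x y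
    have h1 := hΦ' (u ++ k :: l :: v) g
    have h2 := hΦ' (u ++ l :: k :: v) g
    rw [if_pos (by simp; omega)] at h1 h2
    have h3 : Φ' (word G (u.map b) * (groupAlg V G (κ (b k) (b l)) *
        (word G (v.map b) * grp V g))) = _ :=
      hagree (u.length + (0 + v.length)) (by omega) _
        (mul_mem_grade (by simpa using word_mem (G := G) (u.map b))
          (mul_mem_grade (groupAlg_mem_grade _) (by simpa using word_mul_grp_mem (v.map b) g)))
    have h4 := hψ g u k l v h
    rw [← h1, ← h2, ← h3] at h4
    rw [relator_apply, mul_sub, mul_sub, sub_mul, sub_mul, map_sub, map_sub, sub_sub, sub_eq_zero]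
    simpa only [List.map_append, List.map_cons, word_append, word_cons, mul_assoc] using h4

theorem KillsRelations.exists_extension_of_le (hκ_alt : κ.IsAlt) (hκ : IsEquivariant κ)
    (hJ : SatisfiesJacobi κ) {Φ : SmashTensor V G →ₗ[ℂ] M} {n N : ℕ} (hn : n ≤ N)
    (hΦ : KillsRelations κ Φ n) :
    ∃ Φ' : SmashTensor V G →ₗ[ℂ] M, KillsRelations κ Φ' N ∧
      ∀ k ≤ n, ∀ a ∈ grade V G k, Φ' a = Φ a := by
  induction N, hn using Nat.le_induction with
  | base => exact ⟨Φ, hΦ, fun _ _ _ _ => rfl⟩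
  | succ N hN ih =>
    obtain ⟨Φ', h, e⟩ := ih
    obtain ⟨Φ'', h', e'⟩ := h.exists_extension hκ_alt hκ hJ
    exact ⟨Φ'', h', fun k hk a ha => (e' k (hk.trans hN) a ha).trans (e k hk a ha)⟩

end Extension

/-! ### Bijectivity of `ξ` and the Jacobi identity -/

section Comparison

variable {V G : Type*} [AddCommGroup V] [Module ℂ V] [Group G] [DistribMulAction G V]
  [SMulCommClass G ℂ V] (κ : V →ₗ[ℂ] V →ₗ[ℂ] MonoidAlgebra ℂ G)

variable (V G) in
/-- The homomorphism `T(V) → G ⋉ S(V)`. -/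
def tensorToSym : TensorAlgebra ℂ V →ₐ[ℂ] SmashSym V G :=
  TensorAlgebra.lift ℂ ((SkewMonoidAlgebra.lsingle ℂ 1) ∘ₗ SymmetricAlgebra.ι ℂ V)

theorem tensorToSym_ι (x : V) : tensorToSym V G (TensorAlgebra.ι ℂ x) =
    SkewMonoidAlgebra.single 1 (SymmetricAlgebra.ι ℂ V x) :=
  TensorAlgebra.lift_ι_apply _ _

theorem tensorToSym_smul_mul (g : G) (a : TensorAlgebra ℂ V) :
    tensorToSym V G (g • a) * SkewMonoidAlgebra.of (SymmetricAlgebra ℂ V) G g =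
      SkewMonoidAlgebra.of (SymmetricAlgebra ℂ V) G g * tensorToSym V G a := by
  induction a using TensorAlgebra.induction with
  | algebraMap r => rw [smul_algebraMap, AlgHom.commutes, Algebra.commutes]
  | ι x =>
    rw [smul_tensor_ι, tensorToSym_ι, tensorToSym_ι]
    simp [SkewMonoidAlgebra.single_mul_single, smul_sym_ι]
  | mul a b ha hb => rw [smul_mul', map_mul, map_mul, mul_assoc, hb, ← mul_assoc, ha, mul_assoc]
  | add a b ha hb => rw [smul_add, map_add, map_add, add_mul, mul_add, ha, hb]

variable (V G) in
/-- The projection `G ⋉ T(V) → G ⋉ S(V)`. -/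
def toSym : SmashTensor V G →ₐ[ℂ] SmashSym V G :=
  SkewMonoidAlgebra.liftNCAlgHom (tensorToSym V G) (SkewMonoidAlgebra.of (SymmetricAlgebra ℂ V) G)
    (fun {a g} => tensorToSym_smul_mul g a)

theorem toSym_vec (x : V) :
    toSym V G (vec G x) = SkewMonoidAlgebra.single 1 (SymmetricAlgebra.ι ℂ V x) := by
  change SkewMonoidAlgebra.liftNC _ _ (SkewMonoidAlgebra.single _ _) = _
  simp [tensorToSym_ι]

theorem toSym_grp (g : G) : toSym V G (grp V g) = SkewMonoidAlgebra.single g 1 := by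
  change SkewMonoidAlgebra.liftNC _ _ (SkewMonoidAlgebra.single _ _) = _
  simp

theorem toSym_vec_mul_vec (x y : V) :
    toSym V G (vec G x * vec G y) = toSym V G (vec G y * vec G x) := by
  simp [toSym_vec, SkewMonoidAlgebra.single_mul_single, mul_comm]

theorem toSym_surjective : Function.Surjective (toSym V G) := by
  have h1 : ∀ a : SymmetricAlgebra ℂ V,
      SkewMonoidAlgebra.single (1 : G) a ∈ (toSym V G).range := by
    intro a
    induction a using SymmetricAlgebra.induction with
    | algebraMap r => exact Subalgebra.algebraMap_mem _ r
    | ι x => exact ⟨vec G x, toSym_vec x⟩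
    | mul a b ha hb =>
      have := mul_mem ha hb
      rwa [SkewMonoidAlgebra.single_mul_single, one_smul, mul_one] at this
    | add a b ha hb =>
      rw [SkewMonoidAlgebra.single_add]
      exact add_mem ha hb
  rw [← AlgHom.range_eq_top, eq_top_iff]
  rintro z -
  induction z using SkewMonoidAlgebra.induction_on with
  | zero => exact Subalgebra.zero_mem _
  | single g a =>
    have := mul_mem (h1 a) (show SkewMonoidAlgebra.single g 1 ∈ (toSym V G).range from
      ⟨grp V g, toSym_grp g⟩)
    rwa [SkewMonoidAlgebra.single_mul_single, one_smul, mul_one, one_mul] at this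
  | add a b ha hb => exact add_mem ha hb

theorem proj_word_mem (l : List V) : proj κ (word G l) ∈ filt κ l.length :=
  Submodule.subset_span ⟨l, le_rfl, 1, by simp [word, map_list_prod, Function.comp_def]⟩

theorem proj_mem_filt {n : ℕ} {a : SmashTensor V G} (ha : a ∈ grade V G n) :
    proj κ a ∈ filt κ n := by
  have : grade V G n ≤ (filt κ n).comap (proj κ).toLinearMap := by
    refine Submodule.span_le.2 ?_
    rintro _ ⟨l, rfl, g, rfl⟩
    change proj κ (word G l * grp V g) ∈ filt κ l.length
    exact Submodule.subset_span ⟨l, le_rfl, g, by simp [word, map_list_prod, Function.comp_def]⟩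
  exact this ha

theorem xi_toSym_word (l : List V) :
    xi κ (toSym V G (word G l)) = symbol (filt κ) l.length ⟨_, proj_word_mem κ l⟩ := by
  induction l with
  | nil =>
    refine Eq.trans ?_ ((symbol_one (filt κ)).symm.trans (symbol_congr _ rfl (by simp)))
    rw [word_nil, map_one, map_one]
  | cons x l ih =>
    refine Eq.trans ?_ ((symbol_mul (filt κ) ⟨_, vec_mem κ x⟩ ⟨_, proj_word_mem κ l⟩).trans
      (symbol_congr _ (by simp [add_comm]) (by simp)))
    rw [word_cons, map_mul, map_mul, ih, toSym_vec, xi_vec]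
    rfl

/-- On homogeneous elements of G ⋉ T(V), ξ becomes the symbol of the image in H_κ; its kernel is
thereby a question about elements whose degree drops. -/
theorem xi_toSym {n : ℕ} {a : SmashTensor V G} (ha : a ∈ grade V G n) :
    xi κ (toSym V G a) = symbol (filt κ) n ⟨proj κ a, proj_mem_filt κ ha⟩ := by
  induction ha using Submodule.span_induction with
  | zero =>
    rw [map_zero, map_zero]
    exact (map_zero (symbol (filt κ) n)).symm.trans (symbol_congr _ rfl (by simp))
  | add a c ha hc iha ihc =>
    rw [map_add, map_add, iha, ihc, ← map_add]
    exact symbol_congr _ rfl (by simp)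
  | smul r a ha ih =>
    rw [map_smul, map_smul, ih, ← map_smul]
    exact symbol_congr _ rfl (by simp)
  | mem a ha =>
    obtain ⟨l, rfl, g, rfl⟩ := ha
    rw [map_mul, map_mul, xi_toSym_word, toSym_grp, xi_grp]
    exact (symbol_mul (filt κ) ⟨_, proj_word_mem κ l⟩ ⟨_, of_mem κ g⟩).trans
      (symbol_congr _ (by simp) (by simp))

theorem prevStep_filt_le (n : ℕ) :
    prevStep (filt κ) n ≤
      (⨆ k, ⨆ _ : k < n, grade V G k : Submodule ℂ (SmashTensor V G)).map
        (proj κ).toLinearMap := by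
  cases n with
  | zero => exact bot_le
  | succ n =>
    refine Submodule.span_le.2 ?_
    rintro _ ⟨l, hl, g, rfl⟩
    refine ⟨word G l * grp V g, ?_, ?_⟩
    · exact Submodule.mem_iSup_of_mem (p := fun k => ⨆ _ : k < n + 1, grade V G k) l.length
        (Submodule.mem_iSup_of_mem (p := fun _ : l.length < n + 1 => grade V G l.length)
          (Nat.lt_succ_of_le hl) (word_mul_grp_mem l g))
    · simp [word, map_list_prod, Function.comp_def]

/-- The quotient map by the two-sided ideal `I` respects `HRel`, so it factors through H_κ and kills
whatever `proj κ` kills. -/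
theorem mem_span_relator_of_proj_eq_zero {a : SmashTensor V G} (ha : proj κ a = 0) :
    a ∈ TwoSidedIdeal.span {r | ∃ x y : V, r = relator κ x y} := by
  set I := TwoSidedIdeal.span {r | ∃ x y : V, r = relator κ x y} with hI
  have w : ∀ ⦃a c : SmashTensor V G⦄, HRel κ a c → I.ringCon.mk' a = I.ringCon.mk' c := by
    rintro _ _ ⟨x, y⟩
    refine (RingCon.eq _).2 ((TwoSidedIdeal.rel_iff _ _ _).2 ?_)
    exact TwoSidedIdeal.subset_span ⟨x, y, rfl⟩
  have h := RingQuot.lift_mkRingHom_apply I.ringCon.mk' w a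
  have h0 : RingQuot.mkRingHom (HRel κ) a = 0 := by
    rw [← RingQuot.mkAlgHom_coe ℂ]
    exact ha
  rw [h0, map_zero] at h
  have := (RingCon.eq _).1 (h.symm.trans (map_zero I.ringCon.mk').symm)
  exact (TwoSidedIdeal.mem_iff _ _).2 this

variable {κ}

theorem KillsRelations.mono {M : Type*} [AddCommGroup M] [Module ℂ M]
    {Φ : SmashTensor V G →ₗ[ℂ] M} {m n : ℕ} (hmn : m ≤ n) (h : KillsRelations κ Φ n) :
    KillsRelations κ Φ m :=
  fun i j hij => h i j (hij.trans hmn)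

variable [FiniteDimensional ℂ V]

variable (κ) in
/-- An element of the kernel of `G ⋉ T(V) → H_κ` is a consequence of the relations up to some
degree. -/
theorem exists_degree_of_proj_eq_zero (M : Type*) [AddCommGroup M] [Module ℂ M]
    {a : SmashTensor V G} (ha : proj κ a = 0) :
    ∃ N, ∀ Φ : SmashTensor V G →ₗ[ℂ] M, KillsRelations κ Φ N → Φ a = 0 := by
  -- The bound `N` precedes `Φ` in the statement, so a map may be extended up to degree `N` once the
  -- element is known.
  have h := TwoSidedIdeal.mem_span_iff_mem_addSubgroup_closure.1
    (mem_span_relator_of_proj_eq_zero κ ha)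
  clear ha
  induction h using AddSubgroup.closure_induction with
  | zero => exact ⟨0, fun Φ _ => map_zero Φ⟩
  | add a c _ _ iha ihc =>
    obtain ⟨m, hm⟩ := iha
    obtain ⟨n, hn⟩ := ihc
    exact ⟨max m n, fun Φ hΦ => by
      rw [map_add, hm Φ (hΦ.mono (le_max_left m n)), hn Φ (hΦ.mono (le_max_right m n)), add_zero]⟩
  | neg a _ ih =>
    obtain ⟨m, hm⟩ := ih
    exact ⟨m, fun Φ hΦ => by rw [map_neg, hm Φ hΦ, neg_zero]⟩
  | mem a ha =>
    obtain ⟨_, ⟨p, -, _, ⟨x, y, rfl⟩, rfl⟩, q, -, rfl⟩ := ha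
    have hp : p ∈ ⨆ k, grade V G k := iSup_grade (V := V) (G := G) ▸ Submodule.mem_top
    have hq : q ∈ ⨆ k, grade V G k := iSup_grade (V := V) (G := G) ▸ Submodule.mem_top
    change ∃ N, ∀ Φ : SmashTensor V G →ₗ[ℂ] M, KillsRelations κ Φ N →
      Φ (p * relator κ x y * q) = 0
    induction hp using Submodule.iSup_induction' with
    | zero => exact ⟨0, fun Φ _ => by rw [zero_mul, zero_mul, map_zero]⟩
    | add p p' _ _ ih ih' =>
      obtain ⟨m, hm⟩ := ih
      obtain ⟨n, hn⟩ := ih'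
      exact ⟨max m n, fun Φ hΦ => by
        rw [add_mul, add_mul, map_add, hm Φ (hΦ.mono (le_max_left m n)),
          hn Φ (hΦ.mono (le_max_right m n)), add_zero]⟩
    | mem i p hp =>
      induction hq using Submodule.iSup_induction' with
      | zero => exact ⟨0, fun Φ _ => by rw [mul_zero, map_zero]⟩
      | add q q' _ _ ih ih' =>
        obtain ⟨m, hm⟩ := ih
        obtain ⟨n, hn⟩ := ih'
        exact ⟨max m n, fun Φ hΦ => by
          rw [mul_add, map_add, hm Φ (hΦ.mono (le_max_left m n)),
            hn Φ (hΦ.mono (le_max_right m n)), add_zero]⟩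
      | mem j q hq => exact ⟨i + j + 2, fun Φ hΦ => hΦ i j le_rfl p hp q hq x y⟩

/-- The projection to the component of degree `n` of `G ⋉ S(V)`, extended by zero. -/
theorem exists_toSym_component (n : ℕ) :
    ∃ Φ : SmashTensor V G →ₗ[ℂ] SmashSym V G,
      (∀ a ∈ grade V G n, Φ a = toSym V G a) ∧ ∀ k ≠ n, ∀ a ∈ grade V G k, Φ a = 0 := by
  have b := Module.finBasis ℂ V
  obtain ⟨Φ, hΦ⟩ := exists_linearMap_word b fun w (g : G) =>
    if w.length = n then toSym V G (word G (w.map b) * grp V g) else 0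
  refine ⟨Φ, fun a ha => ?_, fun k hk a ha => ?_⟩
  · have : Submodule.span ℂ {a | ∃ w : List (Fin (Module.finrank ℂ V)), w.length = n ∧ ∃ g : G,
        a = word G (w.map b) * grp V g} ≤ LinearMap.eqLocus Φ (toSym V G).toLinearMap := by
      refine Submodule.span_le.2 ?_
      rintro _ ⟨w, hw, g, rfl⟩
      exact (hΦ w g).trans (if_pos hw)
    exact this (grade_le_span_basis b n ha)
  · have : Submodule.span ℂ {a | ∃ w : List (Fin (Module.finrank ℂ V)), w.length = k ∧ ∃ g : G,
        a = word G (w.map b) * grp V g} ≤ LinearMap.ker Φ := by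
      refine Submodule.span_le.2 ?_
      rintro _ ⟨w, hw, g, rfl⟩
      exact (hΦ w g).trans (if_neg (by omega))
    exact this (grade_le_span_basis b k ha)

variable [Finite G]

/-- A homogeneous element of `G ⋉ T(V)` whose image in `H_κ` has smaller degree vanishes in
`G ⋉ S(V)`. -/
theorem toSym_eq_zero_of_proj_mem (hκ_alt : κ.IsAlt) (hκ : IsEquivariant κ)
    (hJ : SatisfiesJacobi κ) {n : ℕ} {a : SmashTensor V G} (ha : a ∈ grade V G n)
    (h : proj κ a ∈ prevStep (filt κ) n) : toSym V G a = 0 := by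
  obtain ⟨c, hc, hca⟩ := prevStep_filt_le κ n h
  obtain ⟨N, hN⟩ := exists_degree_of_proj_eq_zero κ (SmashSym V G) (a := a - c)
    (by rw [map_sub, sub_eq_zero]; exact hca.symm)
  obtain ⟨Φ, h1, h2⟩ := exists_toSym_component (V := V) (G := G) n
  -- In degree n the vectors commute in G ⋉ S(V); in lower degrees, including that of every κ term,
  -- `Φ` is zero.
  have hΦ : KillsRelations κ Φ n := by
    intro i j hij a ha c hc x y
    rw [relator_apply, mul_sub, mul_sub, sub_mul, sub_mul, map_sub, map_sub,
      h2 (i + 0 + j) (by omega) _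
        (mul_mem_grade (mul_mem_grade ha (groupAlg_mem_grade _)) hc), sub_zero, sub_eq_zero]
    have hm : ∀ x y : V, a * (vec G x * vec G y) * c ∈ grade V G (i + 2 + j) := fun x y =>
      mul_mem_grade (mul_mem_grade ha (by simpa using word_mem (G := G) [x, y])) hc
    by_cases hn : i + 2 + j = n
    · rw [h1 _ (hn ▸ hm x y), h1 _ (hn ▸ hm y x), map_mul, map_mul, toSym_vec_mul_vec x y,
        ← map_mul, ← map_mul]
    · rw [h2 _ hn _ (hm x y), h2 _ hn _ (hm y x)]
  obtain ⟨Φ', hΦ', he⟩ := hΦ.exists_extension_of_le hκ_alt hκ hJ (le_max_left n N)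
  have h0 := hN Φ' (hΦ'.mono (le_max_right n N))
  -- The extension still vanishes below degree n, so `Φ' (a - c) = 0` reads `toSym V G a = 0`.
  have hc0 : (⨆ k, ⨆ _ : k < n, grade V G k : Submodule ℂ (SmashTensor V G)) ≤
      LinearMap.ker Φ' :=
    iSup₂_le fun k hk x hx => (he k hk.le x hx).trans (h2 k hk.ne x hx)
  rw [map_sub, LinearMap.mem_ker.1 (hc0 hc), sub_zero, he n le_rfl a ha, h1 a ha] at h0
  exact h0

/-- Symbols of different degrees lie in different summands of gr H_κ, so each homogeneous component
of a lift can be treated separately by `toSym_eq_zero_of_proj_mem`. -/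
theorem xi_injective (hκ_alt : κ.IsAlt) (hκ : IsEquivariant κ) (hJ : SatisfiesJacobi κ) :
    Function.Injective (xi κ) := by
  rw [injective_iff_map_eq_zero]
  intro z hz
  obtain ⟨a, rfl⟩ := toSym_surjective z
  obtain ⟨f, hf, rfl⟩ := (Submodule.mem_iSup_iff_exists_finsupp (grade V G) a).1
    (iSup_grade (V := V) (G := G) ▸ Submodule.mem_top)
  rw [Finsupp.sum, map_sum] at hz ⊢
  refine Finset.sum_eq_zero fun n hn => toSym_eq_zero_of_proj_mem hκ_alt hκ hJ (hf n) ?_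
  rw [map_sum, Finset.sum_congr rfl fun k _ => xi_toSym κ (hf k)] at hz
  have h : grMk (filt κ) n ⟨proj κ (f n), proj_mem_filt κ (hf n)⟩ = 0 := by
    have h := congrArg (DirectSum.component ℂ ℕ (GrPiece (filt κ)) n) hz
    rw [map_sum, Finset.sum_eq_single n, map_zero] at h
    · exact (DirectSum.component.lof_self ℂ n _).symm.trans h
    · exact fun k _ hk => (DirectSum.component.of ℂ n k _).trans (dif_neg hk)
    · exact fun h => absurd hn h
  exact (Submodule.Quotient.mk_eq_zero ((prevStep (filt κ) n).submoduleOf (filt κ n))).1 h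

/-- If `ξ` is injective, then `κ` satisfies the Jacobi identity. -/
theorem satisfiesJacobi_of_xi_injective (h : Function.Injective (xi κ)) : SatisfiesJacobi κ := by
  cases nonempty_fintype G
  intro g x y z
  set v : G → V := fun g => (κ x y).coeff g • (g • z - z) + (κ y z).coeff g • (g • x - x) +
    (κ z x).coeff g • (g • y - y) with hv
  -- In H_κ this is the Jacobi identity for commutators of an associative algebra.
  have hsum : proj κ (∑ g, vec G (v g) * grp V g) = 0 := by
    simp only [hv, map_add, add_mul, Finset.sum_add_distrib, ← groupAlg_commutator]
    simp only [map_sub, map_mul, ← proj_rel]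
    noncomm_ring
  have hmem : ∑ g, vec G (v g) * grp V g ∈ grade V G 1 :=
    sum_mem fun g _ => by simpa using word_mul_grp_mem [v g] g
  have h0 : toSym V G (∑ g, vec G (v g) * grp V g) = 0 := by
    apply h
    rw [xi_toSym κ hmem, map_zero]
    exact (symbol_congr _ rfl (b := 0) hsum).trans (map_zero _)
  have hg : SymmetricAlgebra.ι ℂ V (v g) = 0 := by
    have e : toSym V G (∑ g, vec G (v g) * grp V g) =
        ∑ g, SkewMonoidAlgebra.single g (SymmetricAlgebra.ι ℂ V (v g)) := by
      rw [map_sum]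
      refine Finset.sum_congr rfl fun k _ => ?_
      rw [map_mul, toSym_vec, toSym_grp, SkewMonoidAlgebra.single_mul_single, one_mul, one_smul,
        mul_one]
    have h := congrArg (fun a => SkewMonoidAlgebra.coeffLinearEquiv (S := ℂ) a g) (e.symm.trans h0)
    simp only [map_sum, map_zero, Finsupp.finsetSum_apply, Finsupp.zero_apply] at h
    rw [← h, Finset.sum_eq_single g]
    · exact (Finsupp.single_eq_same (a := g)).symm
    · exact fun k _ hk => Finsupp.single_eq_of_ne' hk
    · simp
  -- V embeds in S(V): every functional on V extends to an algebra homomorphism S(V) → ℂ.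
  rw [← Module.forall_dual_apply_eq_zero_iff ℂ]
  intro φ
  have := congrArg (SymmetricAlgebra.lift φ) hg
  rwa [SymmetricAlgebra.lift_ι_apply, map_zero] at this

end Comparison

/-! ### Solving the Jacobi identity -/

section CoeffForm

variable {V G : Type*} [AddCommGroup V] [Module ℂ V] (κ : V →ₗ[ℂ] V →ₗ[ℂ] MonoidAlgebra ℂ G)

/-- The component of `κ` at a group element. -/
def coeffForm (g : G) : LinearMap.BilinForm ℂ V :=
  κ.compr₂ (Finsupp.lapply g ∘ₗ (MonoidAlgebra.coeffLinearEquiv ℂ).toLinearMap)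

theorem coeffForm_apply (g : G) (x y : V) : coeffForm κ g x y = (κ x y).coeff g := rfl

variable {κ}

theorem coeffForm_isAlt (hκ_alt : κ.IsAlt) (g : G) : (coeffForm κ g).IsAlt := fun x => by
  rw [coeffForm_apply, hκ_alt x]
  rfl

theorem IsEquivariant.coeffForm_conj [Group G] [DistribMulAction G V]
    (hκ : IsEquivariant κ) (g h : G) (x y : V) :
    coeffForm κ (h * g * h⁻¹) (h • x) (h • y) = coeffForm κ g x y := by
  rw [coeffForm_apply, coeffForm_apply, hκ h x y]
  simp [MonoidAlgebra.coeff_mul_single_apply, MonoidAlgebra.coeff_single_mul_apply, mul_assoc]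

end CoeffForm

/-! ### The splitting of V into the image and the kernel of 1 - g -/

section Reflections

variable {V G : Type*} [AddCommGroup V] [Module ℂ V] [Group G] [DistribMulAction G V]
  [SMulCommClass G ℂ V]

theorem oneSub_apply (g : G) (x : V) : oneSub V g x = x - g • x := rfl

theorem one_notMem_reflections : (1 : G) ∉ reflections V G := by
  have h : oneSub V (1 : G) = 0 := by
    ext x
    simp [oneSub_apply]
  intro hs
  have hs' : Module.finrank ℂ (LinearMap.range (oneSub V (1 : G))) = 2 := hs
  rw [h, LinearMap.range_zero, finrank_bot] at hs'
  omega

theorem apply_smul_add_smul {B : LinearMap.BilinForm ℂ V} (hB : B.IsAlt) (x y : V)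
    (a b c d : ℂ) :
    B (a • x + b • y) (c • x + d • y) = (a * d - b * c) * B x y := by
  have h := hB.neg_eq x y
  simp only [map_add, map_smul, LinearMap.add_apply, LinearMap.smul_apply, smul_eq_mul, hB x, hB y,
    ← h]
  ring

theorem oneSub_conj (g h : G) (x : V) :
    oneSub V (h * g * h⁻¹) (h • x) = h • oneSub V g x := by
  simp [oneSub_apply, smul_sub, mul_smul]

/-- For y fixed by g, invariance gives ω(gu, y) = ω(gu, gy) = ω(u, y). -/
theorem apply_range_ker {ω : LinearMap.BilinForm ℂ V}
    (hω_inv : ∀ (g : G) (x y : V), ω (g • x) (g • y) = ω x y) {g : G} {p y : V} (hp : p ∈ LinearMap.range (oneSub V g))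
    (hy : y ∈ LinearMap.ker (oneSub V g)) : ω p y = 0 := by
  obtain ⟨u, rfl⟩ := hp
  have hgy : g • y = y := (sub_eq_zero.1 (LinearMap.mem_ker.1 hy)).symm
  have h := hω_inv g u y
  rw [hgy] at h
  rw [oneSub_apply, map_sub, LinearMap.sub_apply, h, sub_self]

variable [FiniteDimensional ℂ V] [Finite G]

variable (V) in
/-- The projection to the image of `1 - g` along its kernel. -/
abbrev rangeProj (g : G) : V →ₗ[ℂ] V :=
  (LinearMap.range (oneSub V g)).projection (LinearMap.ker (oneSub V g)) (isCompl_oneSub V g)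

theorem rangeProj_mem (g : G) (x : V) : rangeProj V g x ∈ LinearMap.range (oneSub V g) :=
  Submodule.projection_apply_mem _ x

theorem rangeProj_of_mem {g : G} {x : V} (hx : x ∈ LinearMap.range (oneSub V g)) :
    rangeProj V g x = x :=
  Submodule.projection_apply_of_mem_left _ hx

theorem sub_rangeProj_mem (g : G) (x : V) : x - rangeProj V g x ∈ LinearMap.ker (oneSub V g) :=
  Submodule.sub_projection_mem _ x

theorem omegaS_apply (ω : LinearMap.BilinForm ℂ V) (g : G) (x y : V) :
    omegaS ω g x y = ω (rangeProj V g x) (rangeProj V g y) := rfl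

theorem oneSub_rangeProj (g : G) (x : V) : oneSub V g (rangeProj V g x) = oneSub V g x := by
  have := LinearMap.mem_ker.1 (sub_rangeProj_mem g x)
  rw [map_sub, sub_eq_zero] at this
  exact this.symm

theorem rangeProj_conj (g h : G) (x : V) :
    rangeProj V (h * g * h⁻¹) (h • x) = h • rangeProj V g x := by
  have h1 : h • rangeProj V g x ∈ LinearMap.range (oneSub V (h * g * h⁻¹)) := by
    obtain ⟨u, hu⟩ := rangeProj_mem g x
    exact ⟨h • u, by rw [oneSub_conj, hu]⟩
  have h2 : h • (x - rangeProj V g x) ∈ LinearMap.ker (oneSub V (h * g * h⁻¹)) := by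
    rw [LinearMap.mem_ker, oneSub_conj, LinearMap.mem_ker.1 (sub_rangeProj_mem g x), smul_zero]
  have h3 : h • x = h • rangeProj V g x + h • (x - rangeProj V g x) := by
    rw [← smul_add, add_sub_cancel]
  rw [h3, map_add, rangeProj_of_mem h1, (Submodule.projection_apply_eq_zero_iff _).2 h2, add_zero]

variable {ω : LinearMap.BilinForm ℂ V}

theorem omegaS_conj (hω_inv : ∀ (g : G) (x y : V), ω (g • x) (g • y) = ω x y) (g h : G) (x y : V) :
    omegaS ω (h * g * h⁻¹) (h • x) (h • y) = omegaS ω g x y := by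
  rw [omegaS_apply, omegaS_apply, rangeProj_conj, rangeProj_conj, hω_inv]

/-- Image and kernel of 1 - g are complementary and orthogonal, so `ω` stays nondegenerate on the
image. -/
theorem eq_zero_of_apply_range (hω_nondeg : ω.Nondegenerate)
    (hω_inv : ∀ (g : G) (x y : V), ω (g • x) (g • y) = ω x y) {g : G} {p : V}
    (hp : p ∈ LinearMap.range (oneSub V g))
    (h : ∀ q ∈ LinearMap.range (oneSub V g), ω p q = 0) : p = 0 := by
  refine hω_nondeg.1 p fun y => ?_
  rw [← add_sub_cancel (rangeProj V g y) y, map_add, h _ (rangeProj_mem g y),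
    apply_range_ker hω_inv hp (sub_rangeProj_mem g y), add_zero]

theorem exists_omegaS_ne_zero (hω_nondeg : ω.Nondegenerate)
    (hω_inv : ∀ (g : G) (x y : V), ω (g • x) (g • y) = ω x y) {s : G} (hs : s ∈ reflections V G) :
    ∃ x y, omegaS ω s x y ≠ 0 := by
  by_contra! h
  have hbot : LinearMap.range (oneSub V s) = ⊥ := by
    refine (Submodule.eq_bot_iff _).2 fun p hp =>
      eq_zero_of_apply_range hω_nondeg hω_inv hp fun q hq => ?_
    have := h p q
    rwa [omegaS_apply, rangeProj_of_mem hp, rangeProj_of_mem hq] at this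
  have hs' : Module.finrank ℂ (LinearMap.range (oneSub V s)) = 2 := hs
  rw [hbot, finrank_bot] at hs'
  omega

/-- The form `ω_s` of a symplectic reflection satisfies the Jacobi identity. -/
theorem omegaS_jacobi (hω_alt : ω.IsAlt) {s : G} (hs : s ∈ reflections V G) (x y z : V) :
    omegaS ω s x y • oneSub V s z + omegaS ω s y z • oneSub V s x +
      omegaS ω s z x • oneSub V s y = 0 := by
  have b := Module.finBasisOfFinrankEq ℂ (LinearMap.range (oneSub V s)) hs
  have h : ∀ x, ∃ a c : ℂ, rangeProj V s x = a • (b 0 : V) + c • (b 1 : V) := by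
    intro x
    have := congrArg Subtype.val (b.sum_repr ⟨rangeProj V s x, rangeProj_mem s x⟩)
    rw [Fin.sum_univ_two] at this
    exact ⟨_, _, this.symm⟩
  obtain ⟨x₁, x₂, hx⟩ := h x
  obtain ⟨y₁, y₂, hy⟩ := h y
  obtain ⟨z₁, z₂, hz⟩ := h z
  -- Everything now takes place in the plane spanned by `b`, where det(x, y) z + det(y, z) x +
  -- det(z, x) y = 0.
  rw [← oneSub_rangeProj s x, ← oneSub_rangeProj s y, ← oneSub_rangeProj s z]
  rw [omegaS_apply, omegaS_apply, omegaS_apply, hx, hy, hz, apply_smul_add_smul hω_alt,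
    apply_smul_add_smul hω_alt, apply_smul_add_smul hω_alt]
  simp only [map_add, map_smul]
  module

/-- An alternating form satisfying the Jacobi identity for `g ≠ 1` is zero unless `g` is a
symplectic reflection, and in any case is a multiple of `ω_g`. -/
theorem eq_smul_omegaS_of_jacobi [FaithfulSMul G V] (hω_alt : ω.IsAlt)
    (hω_nondeg : ω.Nondegenerate) (hω_inv : ∀ (g : G) (x y : V), ω (g • x) (g • y) = ω x y)
    {g : G} (hg : g ≠ 1) {B : LinearMap.BilinForm ℂ V} (hB : B.IsAlt) (hB0 : B ≠ 0)
    (hJ : ∀ x y z, B x y • oneSub V g z + B y z • oneSub V g x + B z x • oneSub V g y = 0) :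
    g ∈ reflections V G ∧ ∃ a : ℂ, ∀ x y, B x y = a * omegaS ω g x y := by
  obtain ⟨x, y, hxy⟩ : ∃ x y, B x y ≠ 0 := by
    by_contra! h
    exact hB0 (LinearMap.ext₂ h)
  -- Solving the Jacobi identity for (1 - g)z bounds the rank of 1 - g by two.
  have hspan : ∀ x y, B x y ≠ 0 → ∀ p ∈ LinearMap.range (oneSub V g),
      ∃ a c : ℂ, p = a • oneSub V g x + c • oneSub V g y := by
    rintro x y hxy _ ⟨z, rfl⟩
    refine ⟨-(B x y)⁻¹ * B y z, -(B x y)⁻¹ * B z x, ?_⟩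
    have h := congrArg ((B x y)⁻¹ • ·) (hJ x y z)
    simp only [smul_add, smul_smul, inv_mul_cancel₀ hxy, one_smul, smul_zero] at h
    rw [← sub_eq_zero, ← h]
    module
  -- Otherwise `ω` would vanish on the image, which is then zero by nondegeneracy, and g = 1 by
  -- faithfulness.
  have hω : ∀ x y, B x y ≠ 0 → ω (oneSub V g x) (oneSub V g y) ≠ 0 := by
    intro x y hxy h0
    apply hg
    apply FaithfulSMul.eq_of_smul_eq_smul (α := V)
    intro v
    have hv : oneSub V g v = 0 := by
      refine eq_zero_of_apply_range hω_nondeg hω_inv ⟨v, rfl⟩ fun q hq => ?_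
      obtain ⟨a, c, ha⟩ := hspan x y hxy (oneSub V g v) ⟨v, rfl⟩
      obtain ⟨a', c', hq⟩ := hspan x y hxy q hq
      rw [ha, hq, apply_smul_add_smul hω_alt, h0, mul_zero]
    rw [one_smul]
    exact (sub_eq_zero.1 hv).symm
  have hli : ∀ x y, B x y ≠ 0 → ∀ a c : ℂ, a • oneSub V g x + c • oneSub V g y = 0 →
      a = 0 ∧ c = 0 := by
    intro x y hxy a c h
    have h1 := congrArg (fun v => ω v (oneSub V g y)) h
    have h2 := congrArg (ω (oneSub V g x)) h
    simp only [map_add, map_smul, LinearMap.add_apply, LinearMap.smul_apply, smul_eq_mul,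
      hω_alt (oneSub V g _), mul_zero, add_zero, zero_add, map_zero, LinearMap.zero_apply,
      mul_eq_zero, hω x y hxy, or_false] at h1 h2
    exact ⟨h1, h2⟩
  have hker : ∀ x y, B x y ≠ 0 → ∀ z ∈ LinearMap.ker (oneSub V g), B y z = 0 := by
    intro x y hxy z hz
    have h := hJ x y z
    rw [LinearMap.mem_ker.1 hz, smul_zero, zero_add] at h
    exact (hli x y hxy _ _ h).1
  have hker' : ∀ w, ∀ z ∈ LinearMap.ker (oneSub V g), B w z = 0 := by
    intro w z hz
    -- If w does not pair with x, then y + w does, and w is recovered by subtraction.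
    by_cases hw : B x w = 0
    · have h1 := hker x (y + w) (by rwa [map_add, hw, add_zero]) z hz
      rwa [map_add, LinearMap.add_apply, hker x y hxy z hz, zero_add] at h1
    · exact hker x w hw z hz
  -- The kernel of 1 - g lies in the radical of `B`, so `B` lives on the plane that is the image,
  -- where any two alternating forms are proportional.
  have hproj : ∀ v w, B v w = B (rangeProj V g v) (rangeProj V g w) := by
    intro v w
    have h1 := hker' v _ (sub_rangeProj_mem g w)
    have h2 := hker' (rangeProj V g w) _ (sub_rangeProj_mem g v)
    rw [map_sub, sub_eq_zero] at h1 h2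
    rw [h1, ← hB.neg_eq, h2, hB.neg_eq]
  refine ⟨?_, B (oneSub V g x) (oneSub V g y) / ω (oneSub V g x) (oneSub V g y), fun v w => ?_⟩
  · have hr : LinearMap.range (oneSub V g) =
        Submodule.span ℂ (Set.range ![oneSub V g x, oneSub V g y]) := by
      refine le_antisymm (fun p hp => ?_) (Submodule.span_le.2 ?_)
      · obtain ⟨a, c, rfl⟩ := hspan x y hxy p hp
        exact add_mem (Submodule.smul_mem _ _ (Submodule.subset_span ⟨0, rfl⟩))
          (Submodule.smul_mem _ _ (Submodule.subset_span ⟨1, rfl⟩))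
      · rintro _ ⟨i, rfl⟩
        fin_cases i
        · exact ⟨x, rfl⟩
        · exact ⟨y, rfl⟩
    change Module.finrank ℂ (LinearMap.range (oneSub V g)) = 2
    rw [hr, finrank_span_eq_card (LinearIndependent.pair_iff.2 (hli x y hxy)), Fintype.card_fin]
  · obtain ⟨a, c, hv⟩ := hspan x y hxy _ (rangeProj_mem g v)
    obtain ⟨a', c', hw⟩ := hspan x y hxy _ (rangeProj_mem g w)
    rw [hproj v w, omegaS_apply, hv, hw, apply_smul_add_smul hB,
      apply_smul_add_smul hω_alt]
    field_simp [hω x y hxy]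

/-! ### Passing between κ and its components -/

open Classical in
theorem coeff_form (t : ℂ) (c : reflections V G → ℂ) (x y : V) (g : G) :
    (MonoidAlgebra.single 1 (t * ω x y) -
      (2 : ℂ) • ∑ᶠ s : reflections V G,
        MonoidAlgebra.single (s : G) (c s * omegaS ω (s : G) x y)).coeff g =
      (if g = 1 then t * ω x y else 0) -
        2 * (if h : g ∈ reflections V G then c ⟨g, h⟩ * omegaS ω g x y else 0) := by
  cases nonempty_fintype G
  rw [finsum_eq_sum_of_fintype, MonoidAlgebra.coeff_sub, MonoidAlgebra.coeff_smul,
    MonoidAlgebra.coeff_sum, Finsupp.sub_apply, Finsupp.smul_apply, Finsupp.finsetSum_apply,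
    smul_eq_mul, MonoidAlgebra.coeff_single, Finsupp.single_apply]
  congr 2
  · simp only [eq_comm]
  · split_ifs with h
    · rw [Finset.sum_eq_single ⟨g, h⟩]
      · simp
      · intro s _ hs
        have : (s : G) ≠ g := fun e => hs (Subtype.ext e)
        simp [this]
      · simp
    · refine Finset.sum_eq_zero fun s _ => ?_
      have : (s : G) ≠ g := fun e => h (e ▸ s.2)
      simp [this]

variable (κ : V →ₗ[ℂ] V →ₗ[ℂ] MonoidAlgebra ℂ G)

theorem satisfiesJacobi_of_form (hω_alt : ω.IsAlt) (t : ℂ) (c : reflections V G → ℂ)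
    (h : ∀ x y : V, κ x y = MonoidAlgebra.single 1 (t * ω x y) -
      (2 : ℂ) • ∑ᶠ s : reflections V G,
        MonoidAlgebra.single (s : G) (c s * omegaS ω (s : G) x y)) :
    SatisfiesJacobi κ := by
  intro g x y z
  by_cases hg : g = 1
  · subst hg
    simp
  simp only [h, coeff_form, if_neg hg]
  split_ifs with hs
  · have := congrArg ((2 * c ⟨g, hs⟩) • ·) (omegaS_jacobi hω_alt hs x y z)
    simp only [smul_zero, oneSub_apply] at this
    rw [← this]
    generalize g • x = x', g • y = y', g • z = z'
    module
  · simp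

variable {κ}

theorem form_of_satisfiesJacobi [FaithfulSMul G V] (hω_alt : ω.IsAlt)
    (hω_nondeg : ω.Nondegenerate) (hω_inv : ∀ (g : G) (x y : V), ω (g • x) (g • y) = ω x y)
    (hG : ∀ B : LinearMap.BilinForm ℂ V, B.IsAlt →
      (∀ (g : G) (x y : V), B (g • x) (g • y) = B x y) → ∃ a : ℂ, B = a • ω)
    (hκ_alt : κ.IsAlt) (hκ : IsEquivariant κ) (hJ : SatisfiesJacobi κ) :
    ∃ (t : ℂ) (c : reflections V G → ℂ),
      (∀ s s' : reflections V G, IsConj (s : G) (s' : G) → c s = c s') ∧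
      ∀ x y : V, κ x y = MonoidAlgebra.single 1 (t * ω x y) -
        (2 : ℂ) • ∑ᶠ s : reflections V G,
          MonoidAlgebra.single (s : G) (c s * omegaS ω (s : G) x y) := by
  classical
  obtain ⟨t, ht⟩ := hG (coeffForm κ 1) (coeffForm_isAlt hκ_alt 1) fun g x y => by
    simpa using hκ.coeffForm_conj 1 g x y
  have hJ' : ∀ g x y z, coeffForm κ g x y • oneSub V g z + coeffForm κ g y z • oneSub V g x +
      coeffForm κ g z x • oneSub V g y = 0 := by
    intro g x y z
    -- The sign comes from g(z) - z = -(1 - g)z.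
    rw [← neg_eq_zero, ← hJ g x y z]
    simp only [coeffForm_apply, oneSub_apply]
    generalize g • x = x', g • y = y', g • z = z'
    module
  have key : ∀ g : G, g ≠ 1 → coeffForm κ g ≠ 0 → g ∈ reflections V G ∧
      ∃ a : ℂ, ∀ x y, coeffForm κ g x y = a * omegaS ω g x y := fun g hg h0 =>
    eq_smul_omegaS_of_jacobi hω_alt hω_nondeg hω_inv hg (coeffForm_isAlt hκ_alt g) h0 (hJ' g)
  have hc : ∀ s : reflections V G, ∃ a : ℂ,
      ∀ x y, coeffForm κ (s : G) x y = -2 * a * omegaS ω (s : G) x y := by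
    intro s
    by_cases h0 : coeffForm κ (s : G) = 0
    · exact ⟨0, fun x y => by simp [h0]⟩
    · obtain ⟨a, ha⟩ := (key s (fun h => one_notMem_reflections (V := V) (h ▸ s.2)) h0).2
      exact ⟨-a / 2, fun x y => by rw [ha]; ring⟩
  choose c hc using hc
  refine ⟨t, c, fun s s' hss => ?_, fun x y => ?_⟩
  · obtain ⟨h, hh⟩ := isConj_iff.1 hss
    -- Conjugation transports both the component of κ and ω_s; since ω_s is not zero, the
    -- coefficients can be compared at one pair of vectors.
    obtain ⟨x, y, hxy⟩ := exists_omegaS_ne_zero hω_nondeg hω_inv s.2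
    have h1 := hc s' (h • x) (h • y)
    rw [← hh, hκ.coeffForm_conj, omegaS_conj hω_inv, hc s x y] at h1
    have h2 := mul_right_cancel₀ hxy h1
    linear_combination (-1 / 2) * h2
  · rw [← MonoidAlgebra.coeff_inj]
    ext g
    rw [coeff_form, ← coeffForm_apply]
    by_cases hg : g = 1
    · subst hg
      rw [if_pos rfl, dif_neg one_notMem_reflections, ht]
      simp
    · rw [if_neg hg]
      split_ifs with hs
      · rw [hc ⟨g, hs⟩]
        ring
      · have : coeffForm κ g = 0 := by
          by_contra h0
          exact hs (key g hg h0).1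
        simp [this]

end Reflections

end SymplecticReflection

end

theorem mainTheorem1 {V G : Type*} [AddCommGroup V] [Module ℂ V] [FiniteDimensional ℂ V]
    [Group G] [Finite G] [DistribMulAction G V] [SMulCommClass G ℂ V] [FaithfulSMul G V]
    (ω : LinearMap.BilinForm ℂ V) (hω_alt : ω.IsAlt) (hω_nondeg : ω.Nondegenerate)
    (hω_inv : ∀ (g : G) (x y : V), ω (g • x) (g • y) = ω x y)
    (hG : ∀ B : LinearMap.BilinForm ℂ V, B.IsAlt →
      (∀ (g : G) (x y : V), B (g • x) (g • y) = B x y) → ∃ a : ℂ, B = a • ω)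
    (κ : V →ₗ[ℂ] V →ₗ[ℂ] MonoidAlgebra ℂ G) (hκ_alt : κ.IsAlt)
    (hκ_equiv : ∀ (g : G) (x y : V),
      κ (g • x) (g • y) = MonoidAlgebra.of ℂ G g * κ x y * MonoidAlgebra.of ℂ G g⁻¹) :
    Function.Bijective (SymplecticReflection.xi κ) ↔
      ∃ (t : ℂ) (c : SymplecticReflection.reflections V G → ℂ),
        (∀ s s' : SymplecticReflection.reflections V G, IsConj (s : G) (s' : G) → c s = c s') ∧
        ∀ x y : V, κ x y =
          MonoidAlgebra.single 1 (t * ω x y) -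
            (2 : ℂ) • ∑ᶠ s : SymplecticReflection.reflections V G,
              MonoidAlgebra.single (s : G) (c s * SymplecticReflection.omegaS ω (s : G) x y) := by
  constructor
  · intro h
    exact SymplecticReflection.form_of_satisfiesJacobi hω_alt hω_nondeg hω_inv hG hκ_alt hκ_equiv
      (SymplecticReflection.satisfiesJacobi_of_xi_injective h.1)
  · rintro ⟨t, c, -, h⟩
    exact ⟨SymplecticReflection.xi_injective hκ_alt hκ_equiv
      (SymplecticReflection.satisfiesJacobi_of_form κ hω_alt t c h),
      SymplecticReflection.xi_surjective κ⟩
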